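/- **Theorem (Effect of the underestimation policy).** *Setting.* There are $U\ge 1$ users; user $u$ has an unknown preference vector $\theta_u\in\mathbb R^d$, $d\ge1$, with $\|\theta_u\|_2\le 1$, and a dataset of $N_u\ge 1$ pairs $(a_u^i,r_u^i)$, $i=1,\dots,N_u$. Let $\rho$ be a probability distribution on the closed unit ball of $\mathbb R^d$ such that $\mathbb E_{a\sim\rho}[aa^\top]$ has minimum eigenvalue $\lambda_a>0$ and, for some $\sigma>0$ and every unit vector $x$, the variable $(x^\top a)^2$, $a\sim\rho$, is sub-Gaussian about its mean with variance parameter $\sigma^2$ (that is, $\mathbb E\,e^{t((x^\top a)^2-\mathbb E(x^\top a)^2)}\le e^{\sigma^2t^2/2}$ for all $t\in\mathbb R$). In round $i$ of user $u$, a candidate set of at most $S$ actions is drawn independently from $\rho$, independently of the earlier rounds of user $u$; the action $a_u^i$ is selected from it by an arbitrary, possibly randomised and history-dependent rule; and, given the earlier rounds of user $u$, the current candidates and $a_u^i$, the reward $r_u^i$ is drawn from a distribution $R_u(a_u^i)$ which has mean $\langle\theta_u,a_u^i\rangle$ and is 1-sub-Gaussian about it. Put $\tilde\lambda_a=\int_0^{\lambda_a}\bigl(1-e^{-(\lambda_a-x)^2/(2\sigma^2)}\bigr)^S\,dx$.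 *Algorithm.* Let $\alpha\ge 1$, $\lambda>0$ and $\delta\in(0,1)$ satisfy $$\lambda\le d\log\Bigl(1+\frac{\min_uN_u}{\lambda d}\Bigr)+2\log\frac{2U}{\delta},\qquad \delta\le\frac{2U}{1+\max_uN_u/(\lambda d)} .$$ Put $$M_u=\lambda I+\sum_{i=1}^{N_u}a_u^i(a_u^i)^\top,\qquad \hat\theta_u=M_u^{-1}\sum_{i=1}^{N_u}r_u^ia_u^i,\qquad \mathrm{CI}_u=\frac{\sqrt{d\log(1+\frac{N_u}{\lambda d})+2\log\frac{2U}{\delta}}+\sqrt\lambda}{\sqrt{\tilde\lambda_aN_u/2}},$$ $$N_{\min}=\frac{16}{\tilde\lambda_a^2}\log\frac{8Ud}{\tilde\lambda_a^2\delta},\qquad \Gamma(u,v)=\|\hat\theta_u-\hat\theta_v\|_2-\alpha(\mathrm{CI}_u+\mathrm{CI}_v),\qquad M(u)=\{v\ne u:\Gamma(u,v)>0\}.$$ For $g\ge0$ connect distinct users $u,v$ if $\|\hat\theta_u-\hat\theta_v\|_2<g-\alpha(\mathrm{CI}_u+\mathrm{CI}_v)$ and $\min\{N_u,N_v\}\ge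 N_{\min}$, and let $\mathcal W_g(u)$ be the set of neighbours $v$ of $u$ in this graph with $\theta_v\ne\theta_u$. *Claim.* Fix a user $u_{\rm test}$ and choose $\hat\gamma$ by the underestimation policy: $\hat\gamma=\min_{v\in M(u_{\rm test})}\Gamma(u_{\rm test},v)$ if $M(u_{\rm test})\neq\emptyset$, and $\hat\gamma=0$ otherwise. Then, with probability at least $1-\delta$, every $v\in\mathcal W_{\hat\gamma}(u_{\rm test})$ satisfies $$\frac1{\sqrt{N_{u_{\rm test}}}}+\frac1{\sqrt{N_v}}\ \ge\ \alpha_w'\,\|\theta_{u_{\rm test}}-\theta_v\|_2,\qquad \alpha_w'=\frac{\sqrt{\tilde\lambda_a}}{4(\alpha+1)\sqrt{\log(2U/\delta)\,\max\{2,d\}}}.$$ -/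

import Mathlib

open MeasureTheory ProbabilityTheory
open scoped NNReal ENNReal Matrix

namespace OffClusBand

/-- `ℝᵈ` with the Euclidean norm. -/
abbrev Vec (d : ℕ) : Type := EuclideanSpace ℝ (Fin d)

/-- An offline dataset: for each user `u`, the `N u` observed (action, reward) pairs. -/
abbrev Dataset (ι : Type*) (N : ι → ℕ) (d : ℕ) : Type _ := (u : ι) → Fin (N u) → Vec d × ℝ

/-- The numerical parameters used by the algorithm: `α`, `λ`, `δ`, and the smoothed regularity
parameter `lamT`, which is known to the algorithm. -/
structure Params where
  α : ℝ
  lam : ℝ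
  δ : ℝ
  lamT : ℝ

section Model

/-- The matrix `E[a aᵀ]`, for `a ∼ ρ`. -/
noncomputable def secondMoment {d : ℕ} (ρ : Measure (Vec d)) : Matrix (Fin d) (Fin d) ℝ :=
  Matrix.of fun i j => ∫ a, a i * a j ∂ρ

/-- Regularity of the action distribution: `ρ` is a distribution on the closed unit ball, `E[a aᵀ]`
has least eigenvalue `lamA > 0`, and `(xᵀa)²` is sub-Gaussian with variance parameter `σ²` for every
unit vector `x`. -/
structure ActionRegularity {d : ℕ} (ρ : Measure (Vec d)) (lamA σ : ℝ) : Prop where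
  isProb : IsProbabilityMeasure ρ
  norm_le_one : ∀ᵐ a ∂ρ, ‖a‖ ≤ 1
  isLeast_eigenvalue :
    IsLeast {μ : ℝ | Module.End.HasEigenvalue (Matrix.toLin' (secondMoment ρ)) μ} lamA
  lamA_pos : 0 < lamA
  σ_pos : 0 < σ
  subgaussian : ∀ x : Vec d, ‖x‖ = 1 →
    HasSubgaussianMGF (fun a => (inner ℝ x a) ^ 2 - ∫ b, (inner ℝ x b) ^ 2 ∂ρ)
      (⟨σ ^ 2, sq_nonneg σ⟩ : ℝ≥0) ρ

/-- The smoothed regularity parameter `∫₀^{lamA} (1 - exp (-(lamA - x)² / (2σ²)))^S dx`. -/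
noncomputable def smoothedParam (lamA σ : ℝ) (S : ℕ) : ℝ :=
  ∫ x in (0 : ℝ)..lamA, (1 - Real.exp (-(lamA - x) ^ 2 / (2 * σ ^ 2))) ^ S

/-- `R u a` is the reward distribution of user `u` for action `a`: it has mean `⟨θ u, a⟩` and is
1-sub-Gaussian around its mean, for every action `a` of the unit ball. -/
structure RewardModel {ι : Type*} {d : ℕ} (θ : ι → Vec d) (R : ι → Kernel (Vec d) ℝ) : Prop where
  isMarkov : ∀ u, IsMarkovKernel (R u)
  mean_eq : ∀ u a, ‖a‖ ≤ 1 → ∫ r, r ∂(R u a) = inner ℝ (θ u) a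
  subgaussian : ∀ u a, ‖a‖ ≤ 1 → HasSubgaussianMGF (fun r : ℝ => r - inner ℝ (θ u) a) 1 (R u a)

variable {Ω : Type*} {ι : Type*} {N : ι → ℕ} {d : ℕ}

/-- Everything observed for user `u` before round `i`: the earlier candidates, actions, rewards. -/
@[reducible] def history (K : (u : ι) → Fin (N u) → ℕ)
    (X : (u : ι) → (i : Fin (N u)) → Fin (K u i) → Ω → Vec d)
    (a : (u : ι) → Fin (N u) → Ω → Vec d) (r : (u : ι) → Fin (N u) → Ω → ℝ)
    (u : ι) (i : Fin (N u)) : MeasurableSpace Ω :=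
  ⨆ j : Fin (N u), ⨆ _ : j < i,
    (⨆ k, MeasurableSpace.comap (X u j k) inferInstance)
      ⊔ MeasurableSpace.comap (a u j) inferInstance ⊔ MeasurableSpace.comap (r u j) inferInstance

/-- The generation of the offline data. In round `i` of user `u` a fresh set of `K u i ≤ S`
candidates `X u i k` is drawn independently from `ρ`; the logging rule, which is arbitrary (and may
be randomised and depend on the past), picks `a u i` among them; finally the reward
`r u i` is drawn from `R u (a u i)`, i.e. this is its conditional distribution given the past, the
candidates and the chosen action. -/
structure IsOfflineData [MeasurableSpace Ω] (P : Measure Ω) (ρ : Measure (Vec d)) (S : ℕ)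
    (R : ι → Kernel (Vec d) ℝ) (K : (u : ι) → Fin (N u) → ℕ)
    (X : (u : ι) → (i : Fin (N u)) → Fin (K u i) → Ω → Vec d)
    (a : (u : ι) → Fin (N u) → Ω → Vec d) (r : (u : ι) → Fin (N u) → Ω → ℝ) : Prop where
  measurable_cand : ∀ u i k, Measurable (X u i k)
  measurable_action : ∀ u i, Measurable (a u i)
  measurable_reward : ∀ u i, Measurable (r u i)
  card_le : ∀ u i, K u i ≤ S
  cand_law : ∀ u i k, P.map (X u i k) = ρ
  cand_iIndep : ∀ u i, iIndepFun (fun k => X u i k) P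
  cand_fresh : ∀ u i,
    Indep (⨆ k, MeasurableSpace.comap (X u i k) inferInstance) (history K X a r u i) P
  action_mem : ∀ u i, ∀ᵐ ω ∂P, ∃ k, a u i ω = X u i k ω
  reward_law : ∀ u i, ∀ A : Set Ω,
    MeasurableSet[history K X a r u i ⊔ (⨆ k, MeasurableSpace.comap (X u i k) inferInstance)
      ⊔ MeasurableSpace.comap (a u i) inferInstance] A →
    ∀ B : Set ℝ, MeasurableSet B →
      P (A ∩ r u i ⁻¹' B) = ∫⁻ ω in A, R u (a u i ω) B ∂P

end Model

section Algorithm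

variable {ι : Type*} {N : ι → ℕ} {d : ℕ}

/-- `M_u = λ I + ∑ᵢ aᵢ aᵢᵀ`. -/
noncomputable def gram (lam : ℝ) (D : Dataset ι N d) (u : ι) : Matrix (Fin d) (Fin d) ℝ :=
  lam • (1 : Matrix (Fin d) (Fin d) ℝ)
    + ∑ i, Matrix.vecMulVec (D u i).1.ofLp (D u i).1.ofLp

/-- `b_u = ∑ᵢ rᵢ aᵢ`. -/
noncomputable def moment (D : Dataset ι N d) (u : ι) : Vec d :=
  ∑ i, (D u i).2 • (D u i).1

/-- The ridge estimate `M_u⁻¹ b_u`. -/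
noncomputable def ridge (lam : ℝ) (D : Dataset ι N d) (u : ι) : Vec d :=
  WithLp.toLp 2 ((gram lam D u)⁻¹ *ᵥ (moment D u).ofLp)

/-- The confidence width `CI_u` of a user with `n` samples, when there are `U` users. -/
noncomputable def ciWidth (p : Params) (U d n : ℕ) : ℝ :=
  (√(d * Real.log (1 + n / (p.lam * d)) + 2 * Real.log (2 * U / p.δ)) + √p.lam)
    / √(p.lamT * n / 2)

/-- The minimal number of samples of a user that can be connected. -/
noncomputable def nMin (p : Params) (U d : ℕ) : ℝ :=
  16 / p.lamT ^ 2 * Real.log (8 * U * d / (p.lamT ^ 2 * p.δ))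

variable [Fintype ι]

/-- The statistic `Γ(u, v)`. -/
noncomputable def lowerGap (p : Params) (D : Dataset ι N d) (u v : ι) : ℝ :=
  ‖ridge p.lam D u - ridge p.lam D v‖
    - p.α * (ciWidth p (Fintype.card ι) d (N u) + ciWidth p (Fintype.card ι) d (N v))

open Classical in
/-- `M(u)`: the users `v ≠ u` with `Γ(u, v) > 0`. -/
noncomputable def separatedUsers (p : Params) (D : Dataset ι N d) (u : ι) : Finset ι :=
  Finset.univ.filter fun v => v ≠ u ∧ 0 < lowerGap p D u v

open Classical in
/-- The underestimation policy: the least value of `Γ(u, ·)` on `M(u)`, or `0` if `M(u)` is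
empty. -/
noncomputable def underestimate (p : Params) (D : Dataset ι N d) (u : ι) : ℝ :=
  if h : (separatedUsers p D u).Nonempty then
    (separatedUsers p D u).inf' h (lowerGap p D u)
  else 0

/-- The graph built in the cluster phase with threshold `g`. -/
noncomputable def connGraph (p : Params) (D : Dataset ι N d) (g : ℝ) : SimpleGraph ι where
  Adj u v := u ≠ v ∧
    ‖ridge p.lam D u - ridge p.lam D v‖
      < g - p.α * (ciWidth p (Fintype.card ι) d (N u) + ciWidth p (Fintype.card ι) d (N v)) ∧
    nMin p (Fintype.card ι) d ≤ min (N u : ℝ) (N v : ℝ)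
  symm := ⟨fun u v h => ⟨h.1.symm, by
    rw [norm_sub_rev, add_comm (ciWidth p (Fintype.card ι) d (N v)), min_comm]; exact h.2⟩⟩
  loopless := ⟨fun _ h => h.1 rfl⟩

/-- `u` together with its neighbours in the graph with threshold `g`. -/
def neighbors (p : Params) (D : Dataset ι N d) (g : ℝ) (u : ι) : Set ι :=
  {u} ∪ {v | (connGraph p D g).Adj u v}

/-- The heterogeneous neighbours of `u`: those with a different preference vector. -/
def heteroNeighbors (θ : ι → Vec d) (p : Params) (D : Dataset ι N d) (g : ℝ) (u : ι) : Set ι :=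
  {v | v ∈ neighbors p D g u ∧ θ u ≠ θ v}

end Algorithm

end OffClusBand

namespace OffClusBand

/-! The argument splits into a deterministic part and a concentration part.

Deterministic part. If an adjacent user `v` had positive gap to `u`, it would enter the minimum
defining the underestimate, so the threshold would be at most that gap, and adjacency would put the
distance of the estimates below itself. Hence neighbours have nonpositive gap
(`lowerGap_nonpos_of_adj`). If both confidence intervals are valid, the triangle inequality gives a
distance of true preferences of at most `(α + 1)(CI_u + CI_v)`, and `ciWidth_le` bounds each width
by a multiple of `1/√N`. Adjacency forces both sample sizes above the threshold, so only such users
need valid intervals.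

Concentration part. For each such user the interval fails with probability at most `δ/U`, half for
the noise and half for exploration. The ridge error is `M⁻¹s - λM⁻¹θ` with `s` the accumulated noise
(`norm_ridge_sub_le`); it is controlled by the self-normalised size of `s` and by a uniform lower
bound on the explored energy `∑ ⟨x, aᵢ⟩²`. The noise is handled by mixing an exponential
supermartingale over a Gaussian (`measure_self_normalized_gt_le`). For exploration, the selected
action is at least as aligned with `x` as the worst candidate, which is independent of the past and
whose squared alignment has mean at least `t`, the smoothed parameter; this gives an exponential
moment bound in each fixed direction. To reach all directions at once, a poorly explored direction
is thickened to a ball of nearly as poor ones, and the moment bound is integrated over directions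
(`measure_exists_sum_inner_sq_le`). The price `(64/√t)^d` is absorbed by the sample threshold,
because `d * t ≤ 1`. -/

/-- If the `i`-th factor costs at most `c` against every weight that is measurable with respect to
the `i`-th past, then the product of `n` factors has integral at most `c ^ n`. -/
lemma lintegral_prod_le_pow {Ω : Type*} [mΩ : MeasurableSpace Ω] (P : Measure Ω)
    [IsProbabilityMeasure P] {n : ℕ} (H : Fin n → MeasurableSpace Ω)
    (f : Fin n → Ω → ℝ≥0∞) (c : ℝ≥0∞)
    (hmeas : ∀ i j, j < i → Measurable[H i] (f j))
    (hstep : ∀ i (W : Ω → ℝ≥0∞), Measurable[H i] W → ∫⁻ ω, W ω * f i ω ∂P ≤ c * ∫⁻ ω, W ω ∂P) :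
    ∫⁻ ω, ∏ i, f i ω ∂P ≤ c ^ n := by
  have key : ∀ k ≤ n, ∫⁻ ω, ∏ i ∈ Finset.univ.filter (fun i : Fin n => i.val < k), f i ω ∂P
      ≤ c ^ k := by
    intro k
    induction k with
    | zero => intro _; simp
    | succ k ih =>
      intro hk
      have hk' : k < n := hk
      have hset : Finset.univ.filter (fun i : Fin n => i.val < k + 1)
          = insert (⟨k, hk'⟩ : Fin n) (Finset.univ.filter (fun i : Fin n => i.val < k)) := by
        ext i
        simp only [Finset.mem_filter, Finset.mem_univ, true_and, Finset.mem_insert, Fin.ext_iff]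
        omega
      have hW : Measurable[H ⟨k, hk'⟩]
          (fun ω => ∏ i ∈ Finset.univ.filter (fun i : Fin n => i.val < k), f i ω) := by
        refine Finset.measurable_fun_prod _ fun i hi => hmeas _ _ ?_
        simpa [Fin.lt_def] using hi
      calc ∫⁻ ω, ∏ i ∈ Finset.univ.filter (fun i : Fin n => i.val < k + 1), f i ω ∂P
          = ∫⁻ ω, (∏ i ∈ Finset.univ.filter (fun i : Fin n => i.val < k), f i ω)
              * f ⟨k, hk'⟩ ω ∂P := by
            refine lintegral_congr fun ω => ?_
            rw [hset, Finset.prod_insert (by simp), mul_comm]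
        _ ≤ c * c ^ k := (hstep _ _ hW).trans (by gcongr; exact ih hk'.le)
        _ = c ^ (k + 1) := by ring
  have := key n le_rfl
  simpa using this

/-! ### Spectrum of the second moment and alignment of the worst candidate -/

lemma inner_secondMoment {d : ℕ} {ρ : Measure (Vec d)} [IsProbabilityMeasure ρ]
    (hb : ∀ᵐ a ∂ρ, ‖a‖ ≤ 1) (x : Vec d) :
    ∫ a, (inner ℝ x a) ^ 2 ∂ρ = x.ofLp ⬝ᵥ (secondMoment ρ *ᵥ x.ofLp) := by
  have hint : ∀ i j, Integrable (fun a : Vec d => a i * a j) ρ := by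
    intro i j
    refine Integrable.of_bound (by fun_prop) 1 ?_
    filter_upwards [hb] with a ha
    rw [norm_mul]
    have h1 := (PiLp.norm_apply_le a i).trans ha
    have h2 := (PiLp.norm_apply_le a j).trans ha
    exact mul_le_one₀ h1 (norm_nonneg _) h2
  have hexp : ∀ a : Vec d, (inner ℝ x a) ^ 2 = ∑ i, ∑ j, x i * (x j * (a i * a j)) := by
    intro a
    rw [PiLp.inner_apply, sq, Finset.sum_mul_sum]
    refine Finset.sum_congr rfl fun i _ => Finset.sum_congr rfl fun j _ => ?_
    simp; ring
  simp_rw [hexp]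
  rw [integral_finsetSum _ fun i _ => integrable_finsetSum _ fun j _ =>
    ((hint i j).const_mul _).const_mul _]
  simp only [dotProduct, Matrix.mulVec, secondMoment, Matrix.of_apply]
  refine Finset.sum_congr rfl fun i _ => ?_
  rw [integral_finsetSum _ fun j _ => ((hint i j).const_mul _).const_mul _, Finset.mul_sum]
  refine Finset.sum_congr rfl fun j _ => ?_
  rw [integral_const_mul, integral_const_mul]; ring

/-- The infimum of the Rayleigh quotient of a symmetric operator is itself an eigenvalue, so the
least eigenvalue lies below every value of the quotient. -/
lemma ActionRegularity.le_integral_inner_sq {d : ℕ} {ρ : Measure (Vec d)} {lamA σ : ℝ}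
    (hρ : ActionRegularity ρ lamA σ) {x : Vec d} (hx : ‖x‖ = 1) :
    lamA ≤ ∫ a, (inner ℝ x a) ^ 2 ∂ρ := by
  have := hρ.isProb
  have hx0 : x ≠ 0 := by rintro rfl; simp at hx
  have : Nontrivial (Vec d) := ⟨x, 0, hx0⟩
  have hsym : (secondMoment ρ).IsHermitian := by
    ext i j; simp [secondMoment, mul_comm]
  have hsymm : (Matrix.toEuclideanLin (secondMoment ρ)).IsSymmetric :=
    Matrix.isSymmetric_toEuclideanLin_iff.mpr hsym
  have hval : ∀ y : Vec d, inner ℝ (Matrix.toEuclideanLin (secondMoment ρ) y) y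
      = ∫ a, (inner ℝ y a) ^ 2 ∂ρ := by
    intro y
    rw [inner_secondMoment hρ.norm_le_one, EuclideanSpace.inner_eq_star_dotProduct]
    simp [Matrix.toLpLin_apply]
  have hev := hsymm.hasEigenvalue_iInf_of_finiteDimensional
  set m : ℝ := (⨅ y : { y : Vec d // y ≠ 0 },
    RCLike.re (inner ℝ (Matrix.toEuclideanLin (secondMoment ρ) y) (y : Vec d))
      / ‖(y : Vec d)‖ ^ 2 : ℝ) with hm
  have hmem : Module.End.HasEigenvalue (Matrix.toLin' (secondMoment ρ)) m := by
    obtain ⟨v, hv⟩ := hev.exists_hasEigenvector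
    refine Module.End.hasEigenvalue_of_hasEigenvector (x := v.ofLp) ?_
    rw [Module.End.hasEigenvector_iff, Module.End.mem_eigenspace_iff] at hv ⊢
    refine ⟨?_, ?_⟩
    · have := congrArg WithLp.ofLp hv.1
      simpa [Matrix.toLpLin_apply] using this
    · intro h; exact hv.2 (by ext i; simp [h])
  refine (hρ.isLeast_eigenvalue.2 hmem).trans ?_
  have hbdd : BddBelow (Set.range fun y : { y : Vec d // y ≠ 0 } =>
      (RCLike.re (inner ℝ (Matrix.toEuclideanLin (secondMoment ρ) y) (y : Vec d))
      / ‖(y : Vec d)‖ ^ 2 : ℝ)) := by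
    refine ⟨0, ?_⟩
    rintro _ ⟨y, rfl⟩
    simp only [hval, RCLike.re_to_real]
    have : 0 ≤ ∫ a, (inner ℝ (y : Vec d) a) ^ 2 ∂ρ := integral_nonneg fun a => sq_nonneg _
    positivity
  have := ciInf_le hbdd ⟨x, hx0⟩
  rw [← hm] at this
  simpa only [hval, RCLike.re_to_real, hx, one_pow, div_one] using this

/-- Summing the quadratic form over an orthonormal basis gives `E‖a‖² ≤ 1`. This later trades a
factor `1/t` in the sample threshold for the dimension. -/
lemma ActionRegularity.mul_lamA_le_one {d : ℕ} {ρ : Measure (Vec d)} {lamA σ : ℝ}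
    (hρ : ActionRegularity ρ lamA σ) : d * lamA ≤ 1 := by
  have := hρ.isProb
  have hint : ∀ i : Fin d, Integrable
      (fun a : Vec d => (inner ℝ (EuclideanSpace.single i (1 : ℝ)) a) ^ 2) ρ := by
    intro i
    refine Integrable.of_bound (by fun_prop) 1 ?_
    filter_upwards [hρ.norm_le_one] with a ha
    have h1 := (PiLp.norm_apply_le a i).trans ha
    rw [EuclideanSpace.inner_single_left, norm_pow]
    simpa using pow_le_one₀ (n := 2) (abs_nonneg _) h1
  calc (d : ℝ) * lamA = ∑ _i : Fin d, lamA := by simp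
    _ ≤ ∑ i : Fin d, ∫ a, (inner ℝ (EuclideanSpace.single i (1 : ℝ)) a) ^ 2 ∂ρ :=
        Finset.sum_le_sum fun i _ => hρ.le_integral_inner_sq (by simp)
    _ = ∫ a, ∑ i : Fin d, (inner ℝ (EuclideanSpace.single i (1 : ℝ)) a) ^ 2 ∂ρ :=
        (integral_finsetSum _ fun i _ => hint i).symm
    _ ≤ ∫ _, (1 : ℝ) ∂ρ := by
        refine integral_mono_ae (integrable_finsetSum _ fun i _ => hint i) (by simp) ?_
        filter_upwards [hρ.norm_le_one] with a ha
        have : ∑ i : Fin d, (inner ℝ (EuclideanSpace.single i (1 : ℝ)) a) ^ 2 = ‖a‖ ^ 2 := by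
          rw [EuclideanSpace.real_norm_sq_eq]; simp [EuclideanSpace.inner_single_left]
        simp only [this]
        exact pow_le_one₀ (norm_nonneg _) ha
    _ = 1 := by simp

lemma ActionRegularity.measure_inner_sq_le {d : ℕ} {ρ : Measure (Vec d)} {lamA σ : ℝ}
    (hρ : ActionRegularity ρ lamA σ) {x : Vec d} (hx : ‖x‖ = 1) {t : ℝ} (ht : t ≤ lamA) :
    ρ.real {a | (inner ℝ x a) ^ 2 ≤ t} ≤ Real.exp (-(lamA - t) ^ 2 / (2 * σ ^ 2)) := by
  have := hρ.isProb
  have h := (hρ.subgaussian x hx).neg.measure_ge_le (ε := lamA - t) (by linarith)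
  refine le_trans (measureReal_mono ?_ (by finiteness)) h
  intro a ha
  have := hρ.le_integral_inner_sq hx
  simp only [Set.mem_ofPred_eq, Pi.neg_apply] at ha ⊢
  linarith

lemma smoothedParam_le {lamA : ℝ} (h : 0 ≤ lamA) (σ : ℝ) (S : ℕ) :
    smoothedParam lamA σ S ≤ lamA := by
  have := intervalIntegral.integral_mono_on (μ := volume) (a := 0) (b := lamA)
    (f := fun x => (1 - Real.exp (-(lamA - x) ^ 2 / (2 * σ ^ 2))) ^ S) (g := fun _ => 1) h
    (Continuous.intervalIntegrable (by fun_prop) _ _) (by simp) ?_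
  · simpa [smoothedParam] using this
  · intro x _
    refine pow_le_one₀ ?_ (by linarith [Real.exp_pos (-(lamA - x) ^ 2 / (2 * σ ^ 2))])
    have : Real.exp (-(lamA - x) ^ 2 / (2 * σ ^ 2)) ≤ 1 := by
      rw [Real.exp_le_one_iff, neg_div]
      have : 0 ≤ (lamA - x) ^ 2 / (2 * σ ^ 2) := by positivity
      linarith
    linarith

/-- The worst alignment of `k` candidates with a direction has mean at least the smoothed
regularity parameter. -/
lemma ActionRegularity.smoothedParam_le_lintegral_iInf {Ω : Type*} [MeasurableSpace Ω]
    {P : Measure Ω} [IsProbabilityMeasure P] {d : ℕ} {ρ : Measure (Vec d)} {lamA σ : ℝ}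
    (hρ : ActionRegularity ρ lamA σ) {S k : ℕ} (hk : 0 < k) (hkS : k ≤ S)
    {Y : Fin k → Ω → Vec d} (hY : ∀ j, Measurable (Y j)) (hlaw : ∀ j, P.map (Y j) = ρ)
    (hind : iIndepFun Y P) {x : Vec d} (hx : ‖x‖ = 1) :
    ENNReal.ofReal (smoothedParam lamA σ S)
      ≤ ∫⁻ ω, ENNReal.ofReal (⨅ j, (inner ℝ x (Y j ω)) ^ 2) ∂P := by
  have := hρ.isProb
  have : Nonempty (Fin k) := ⟨⟨0, hk⟩⟩
  have hmeas : Measurable fun ω => ⨅ j, (inner ℝ x (Y j ω) : ℝ) ^ 2 :=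
    Measurable.iInf fun j => by have := hY j; fun_prop
  rw [lintegral_eq_lintegral_meas_lt P
    (Filter.Eventually.of_forall fun ω => Real.iInf_nonneg fun j => sq_nonneg _)
    hmeas.aemeasurable]
  -- After the layer-cake formula the task is a lower bound on the probability that all candidates
  -- exceed level `t`; `q t` bounds it for one candidate when `t ≤ lamA`. Independence then gives `q
  -- t ^ k`, and `k ≤ S` with `q t ≤ 1` gives `q t ^ S`.
  set q : ℝ → ℝ := fun t => 1 - Real.exp (-(lamA - t) ^ 2 / (2 * σ ^ 2)) with hq
  have hq0 : ∀ t, 0 ≤ q t := by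
    intro t
    have : Real.exp (-(lamA - t) ^ 2 / (2 * σ ^ 2)) ≤ 1 := by
      rw [Real.exp_le_one_iff, neg_div]
      have : 0 ≤ (lamA - t) ^ 2 / (2 * σ ^ 2) := by positivity
      linarith
    simp only [hq]; linarith
  have hq1 : ∀ t, q t ≤ 1 := fun t => by
    simp only [hq]; linarith [Real.exp_pos (-(lamA - t) ^ 2 / (2 * σ ^ 2))]
  have hsm : ENNReal.ofReal (smoothedParam lamA σ S)
      = ∫⁻ t in Set.Ioc 0 lamA, ENNReal.ofReal (q t ^ S) := by
    rw [smoothedParam, intervalIntegral.integral_of_le hρ.lamA_pos.le]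
    refine ofReal_integral_eq_lintegral_ofReal ?_
      (Filter.Eventually.of_forall fun t => pow_nonneg (hq0 t) S)
    exact ((by fun_prop : Continuous fun t => q t ^ S).intervalIntegrable 0 lamA).1
  rw [hsm]
  calc ∫⁻ t in Set.Ioc 0 lamA, ENNReal.ofReal (q t ^ S)
      ≤ ∫⁻ t in Set.Ioc 0 lamA, P {ω | t < ⨅ j, (inner ℝ x (Y j ω)) ^ 2} := by
        refine setLIntegral_mono' measurableSet_Ioc fun t ht => ?_
        have hset : {ω | t < ⨅ j, (inner ℝ x (Y j ω) : ℝ) ^ 2}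
            = ⋂ j ∈ (Finset.univ : Finset (Fin k)), Y j ⁻¹' {a | t < (inner ℝ x a) ^ 2} := by
          ext ω
          simp only [Set.mem_ofPred_eq, Set.mem_iInter, Finset.mem_univ, true_imp_iff,
            Set.mem_preimage]
          refine ⟨fun h j => h.trans_le (ciInf_le (Finite.bddBelow_range _) j), fun h => ?_⟩
          obtain ⟨j, hj⟩ := exists_eq_ciInf_of_finite (f := fun j => (inner ℝ x (Y j ω) : ℝ) ^ 2)
          rw [← hj]
          exact h j
        have hms : MeasurableSet {a : Vec d | t < (inner ℝ x a : ℝ) ^ 2} :=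
          measurableSet_lt measurable_const (by fun_prop)
        have hone : ∀ j, ENNReal.ofReal (q t) ≤ P (Y j ⁻¹' {a | t < (inner ℝ x a) ^ 2}) := by
          intro j
          rw [← Measure.map_apply (hY j) hms, hlaw j]
          have hc : {a : Vec d | t < (inner ℝ x a : ℝ) ^ 2}
              = {a : Vec d | (inner ℝ x a : ℝ) ^ 2 ≤ t}ᶜ := by
            ext a; simp
          have hms' : MeasurableSet {a : Vec d | (inner ℝ x a : ℝ) ^ 2 ≤ t} :=
            measurableSet_le (by fun_prop) measurable_const
          rw [← ofReal_measureReal, hc, probReal_compl_eq_one_sub hms']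
          exact ENNReal.ofReal_le_ofReal (by
            have := hρ.measure_inner_sq_le hx ht.2; simp only [hq]; linarith)
        rw [hset, hind.measure_inter_preimage_eq_mul _ fun j _ => hms]
        calc ENNReal.ofReal (q t ^ S) ≤ ENNReal.ofReal (q t ^ k) :=
              ENNReal.ofReal_le_ofReal (pow_le_pow_of_le_one (hq0 t) (hq1 t) hkS)
          _ = ∏ _j : Fin k, ENNReal.ofReal (q t) := by
              rw [ENNReal.ofReal_pow (hq0 t)]; simp
          _ ≤ _ := Finset.prod_le_prod' fun j _ => hone j
    _ ≤ _ := lintegral_mono_set Set.Ioc_subset_Ioi_self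

/-- A linear majorant turns knowledge of the mean alone into a Laplace transform bound. The rate
8/25 exceeds half of 2/5 by enough to pay for Markov's inequality at half the mean and for the later
perturbations. -/
lemma exp_neg_two_fifths_le {z : ℝ} (h0 : 0 ≤ z) (h1 : z ≤ 1) :
    Real.exp (-(2 / 5 * z)) ≤ 1 - 8 / 25 * z := by
  have h := Real.quadratic_le_exp_of_nonneg (x := 2 / 5 * z) (by positivity)
  rw [Real.exp_neg]
  refine inv_le_of_inv_le₀ (by linarith) (le_trans ?_ h)
  rw [inv_le_iff_one_le_mul₀ (by linarith)]
  nlinarith [mul_nonneg h0 (sub_nonneg.2 h1), mul_nonneg (mul_nonneg h0 h0) (sub_nonneg.2 h1)]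

lemma lintegral_exp_neg_le {Ω : Type*} [MeasurableSpace Ω] {P : Measure Ω} [IsProbabilityMeasure P]
    {Z : Ω → ℝ} (hZ : Measurable Z) (h0 : ∀ ω, 0 ≤ Z ω) (h1 : ∀ᵐ ω ∂P, Z ω ≤ 1) {t : ℝ}
    (ht : ENNReal.ofReal t ≤ ∫⁻ ω, ENNReal.ofReal (Z ω) ∂P) {b : ℝ} (hb : b ^ 2 ≤ 1) :
    ∫⁻ ω, ENNReal.ofReal (Real.exp (-(2 / 5 * (b ^ 2 * Z ω)))) ∂P
      ≤ ENNReal.ofReal (Real.exp (-(8 / 25 * (t * b ^ 2)))) := by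
  have hint : Integrable Z P := Integrable.of_bound hZ.aestronglyMeasurable 1 (by
    filter_upwards [h1] with ω hω
    rwa [Real.norm_eq_abs, abs_of_nonneg (h0 ω)])
  rw [← ofReal_integral_eq_lintegral_ofReal hint (Filter.Eventually.of_forall h0),
    ENNReal.ofReal_le_ofReal_iff (integral_nonneg h0)] at ht
  have hle : ∀ᵐ ω ∂P, Real.exp (-(2 / 5 * (b ^ 2 * Z ω))) ≤ 1 - 8 / 25 * (b ^ 2 * Z ω) := by
    filter_upwards [h1] with ω hω
    exact exp_neg_two_fifths_le (mul_nonneg (sq_nonneg b) (h0 ω))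
      (mul_le_one₀ hb (h0 ω) hω)
  have hint2 : Integrable (fun ω => 1 - 8 / 25 * (b ^ 2 * Z ω)) P :=
    (integrable_const 1).sub ((hint.const_mul _).const_mul _)
  have hnn : ∀ᵐ ω ∂P, 0 ≤ 1 - 8 / 25 * (b ^ 2 * Z ω) := by
    filter_upwards [hle] with ω hω using (Real.exp_pos _).le.trans hω
  calc _ ≤ ∫⁻ ω, ENNReal.ofReal (1 - 8 / 25 * (b ^ 2 * Z ω)) ∂P := by
        refine lintegral_mono_ae ?_
        filter_upwards [hle] with ω hω using ENNReal.ofReal_le_ofReal hω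
    _ = ENNReal.ofReal (∫ ω, (1 - 8 / 25 * (b ^ 2 * Z ω)) ∂P) :=
        (ofReal_integral_eq_lintegral_ofReal hint2 hnn).symm
    _ ≤ _ := by
        refine ENNReal.ofReal_le_ofReal ?_
        rw [integral_sub (integrable_const 1) ((hint.const_mul _).const_mul _),
          integral_const_mul, integral_const_mul]
        simp only [integral_const, probReal_univ, smul_eq_mul, mul_one]
        have h2 := Real.add_one_le_exp (-(8 / 25 * (t * b ^ 2)))
        nlinarith [mul_le_mul_of_nonneg_right ht (sq_nonneg b)]

/-! ### Exploration in one fixed direction -/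

section History

variable {Ω : Type*} {ι : Type*} {N : ι → ℕ} {d : ℕ} {K : (u : ι) → Fin (N u) → ℕ}
  {X : (u : ι) → (i : Fin (N u)) → Fin (K u i) → Ω → Vec d}
  {a : (u : ι) → Fin (N u) → Ω → Vec d} {r : (u : ι) → Fin (N u) → Ω → ℝ}

lemma measurable_cand_history {u : ι} {i j : Fin (N u)} (h : j < i) (k : Fin (K u j)) :
    Measurable[history K X a r u i] (X u j k) := by
  refine measurable_iff_comap_le.2 (le_trans ?_ (le_iSup₂_of_le j h le_rfl))
  exact le_sup_of_le_left (le_sup_of_le_left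
    (le_iSup (fun k => MeasurableSpace.comap (X u j k) inferInstance) k))

lemma measurable_action_history {u : ι} {i j : Fin (N u)} (h : j < i) :
    Measurable[history K X a r u i] (a u j) := by
  refine measurable_iff_comap_le.2 (le_trans ?_ (le_iSup₂_of_le j h le_rfl))
  exact le_sup_of_le_left le_sup_right

lemma measurable_reward_history {u : ι} {i j : Fin (N u)} (h : j < i) :
    Measurable[history K X a r u i] (r u j) := by
  refine measurable_iff_comap_le.2 (le_trans ?_ (le_iSup₂_of_le j h le_rfl))
  exact le_sup_right

end History

section Data

variable {Ω : Type*} [mΩ : MeasurableSpace Ω] {P : Measure Ω}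
  {ι : Type*} {N : ι → ℕ} {d : ℕ} {ρ : Measure (Vec d)} {lamA σ : ℝ} {S : ℕ}
  {R : ι → Kernel (Vec d) ℝ} {K : (u : ι) → Fin (N u) → ℕ}
  {X : (u : ι) → (i : Fin (N u)) → Fin (K u i) → Ω → Vec d}
  {a : (u : ι) → Fin (N u) → Ω → Vec d} {r : (u : ι) → Fin (N u) → Ω → ℝ}

lemma IsOfflineData.norm_cand_le (hdata : IsOfflineData P ρ S R K X a r)
    (hb : ∀ᵐ a ∂ρ, ‖a‖ ≤ 1) (u : ι) (i : Fin (N u)) : ∀ᵐ ω ∂P, ∀ k, ‖X u i k ω‖ ≤ 1 := by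
  refine ae_all_iff.2 fun k => ?_
  rw [← hdata.cand_law u i k] at hb
  exact ae_of_ae_map (hdata.measurable_cand u i k).aemeasurable hb

lemma IsOfflineData.cand_le (hdata : IsOfflineData P ρ S R K X a r) (u : ι) (i : Fin (N u)) :
    (⨆ k, MeasurableSpace.comap (X u i k) inferInstance) ≤ mΩ :=
  iSup_le fun k => (hdata.measurable_cand u i k).comap_le

lemma IsOfflineData.history_le (hdata : IsOfflineData P ρ S R K X a r) (u : ι) (i : Fin (N u)) :
    history K X a r u i ≤ mΩ :=
  iSup₂_le fun j _ => sup_le (sup_le (hdata.cand_le u j) (hdata.measurable_action u j).comap_le)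
    (hdata.measurable_reward u j).comap_le

lemma IsOfflineData.norm_action_le (hdata : IsOfflineData P ρ S R K X a r)
    (hb : ∀ᵐ a ∂ρ, ‖a‖ ≤ 1) (u : ι) : ∀ᵐ ω ∂P, ∀ i, ‖a u i ω‖ ≤ 1 := by
  refine ae_all_iff.2 fun i => ?_
  filter_upwards [hdata.norm_cand_le hb u i, hdata.action_mem u i] with ω h1 ⟨k, h2⟩
  rw [h2]; exact h1 k

variable [IsProbabilityMeasure P]

lemma IsOfflineData.card_pos (hdata : IsOfflineData P ρ S R K X a r) (u : ι) (i : Fin (N u)) :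
    0 < K u i := by
  obtain ⟨ω, k, -⟩ := (hdata.action_mem u i).exists
  exact k.pos

/-- Whatever the logging rule, the observed actions of a user explore a given unit direction: an
exponential lower-tail bound. -/
lemma IsOfflineData.lintegral_exp_neg_sum_unit (hdata : IsOfflineData P ρ S R K X a r)
    (hρ : ActionRegularity ρ lamA σ) (u : ι) {x : Vec d} (hx : ‖x‖ = 1) {b : ℝ} (hb : b ^ 2 ≤ 1) :
    ∫⁻ ω, ENNReal.ofReal (Real.exp (-(2 / 5 * (b ^ 2 * ∑ i, (inner ℝ x (a u i ω)) ^ 2)))) ∂P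
      ≤ ENNReal.ofReal (Real.exp (-(8 / 25 * (smoothedParam lamA σ S * b ^ 2) * N u))) := by
  -- The worst candidate replaces the selected action: it does not depend on the logging rule, only
  -- on the current candidates, hence is independent of the history.
  set Z : Fin (N u) → Ω → ℝ := fun i ω => ⨅ k, (inner ℝ x (X u i k ω)) ^ 2 with hZdef
  have hZm : ∀ i (m : MeasurableSpace Ω), (∀ k, Measurable[m] (X u i k)) → Measurable[m] (Z i) := by
    intro i m h
    refine Measurable.iInf fun k => ?_
    have := h k
    fun_prop
  have hfm : ∀ i (m : MeasurableSpace Ω), (∀ k, Measurable[m] (X u i k)) →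
      Measurable[m] fun ω => ENNReal.ofReal (Real.exp (-(2 / 5 * (b ^ 2 * Z i ω)))) := by
    intro i m h
    have := hZm i m h
    fun_prop
  have hZ0 : ∀ i ω, 0 ≤ Z i ω := fun i ω => Real.iInf_nonneg fun k => sq_nonneg _
  have hZ1 : ∀ i, ∀ᵐ ω ∂P, Z i ω ≤ 1 := by
    intro i
    filter_upwards [hdata.norm_cand_le hρ.norm_le_one u i] with ω hω
    refine (ciInf_le (Finite.bddBelow_range _) ⟨0, hdata.card_pos u i⟩).trans ?_
    rw [sq_le_one_iff_abs_le_one]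
    refine (abs_real_inner_le_norm _ _).trans ?_
    rw [hx, one_mul]; exact hω _
  have hprod := lintegral_prod_le_pow P (history K X a r u)
    (fun i ω => ENNReal.ofReal (Real.exp (-(2 / 5 * (b ^ 2 * Z i ω)))))
    (ENNReal.ofReal (Real.exp (-(8 / 25 * (smoothedParam lamA σ S * b ^ 2)))))
    (fun i j hji => hfm j _ fun k => measurable_cand_history hji k)
    (fun i W hW => by
      rw [lintegral_mul_eq_lintegral_mul_lintegral_of_independent_measurableSpace
        (hdata.history_le u i) (hdata.cand_le u i) (hdata.cand_fresh u i).symm hW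
        (hfm i _ fun k => measurable_iff_comap_le.2
          (le_iSup (fun k => MeasurableSpace.comap (X u i k) inferInstance) k)), mul_comm]
      gcongr
      exact lintegral_exp_neg_le (hZm i _ (hdata.measurable_cand u i)) (hZ0 i) (hZ1 i)
        (hρ.smoothedParam_le_lintegral_iInf (hdata.card_pos u i) (hdata.card_le u i)
          (hdata.measurable_cand u i) (hdata.cand_law u i) (hdata.cand_iIndep u i) hx) hb)
  rw [← ENNReal.ofReal_pow (Real.exp_nonneg _), ← Real.exp_nat_mul] at hprod
  refine le_trans ?_ (hprod.trans (ENNReal.ofReal_le_ofReal (le_of_eq (by congr 1; ring))))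
  refine lintegral_mono_ae ?_
  filter_upwards [ae_all_iff.2 (hdata.action_mem u)] with ω hω
  rw [← ENNReal.ofReal_prod_of_nonneg fun _ _ => Real.exp_nonneg _, ← Real.exp_sum]
  refine ENNReal.ofReal_le_ofReal (Real.exp_le_exp.2 ?_)
  rw [Finset.sum_neg_distrib, ← Finset.mul_sum, ← Finset.mul_sum]
  have : ∑ i, Z i ω ≤ ∑ i, (inner ℝ x (a u i ω)) ^ 2 := by
    refine Finset.sum_le_sum fun i _ => ?_
    obtain ⟨k, hk⟩ := hω i
    rw [hk]
    exact ciInf_le (Finite.bddBelow_range _) k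
  have := mul_le_mul_of_nonneg_left this (sq_nonneg b)
  linarith

lemma IsOfflineData.lintegral_exp_neg_sum (hdata : IsOfflineData P ρ S R K X a r)
    (hρ : ActionRegularity ρ lamA σ) (u : ι) {x : Vec d} (hx : ‖x‖ ≤ 1) :
    ∫⁻ ω, ENNReal.ofReal (Real.exp (-(2 / 5 * ∑ i, (inner ℝ x (a u i ω)) ^ 2))) ∂P
      ≤ ENNReal.ofReal (Real.exp (-(8 / 25 * (smoothedParam lamA σ S * ‖x‖ ^ 2) * N u))) := by
  rcases eq_or_ne x 0 with rfl | h0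
  · simp
  -- The length of `x` is carried by `b`. Vectors shorter than one are needed because the averaging
  -- over directions takes place inside the unit ball.
  have h := hdata.lintegral_exp_neg_sum_unit hρ u (x := (‖x‖⁻¹ : ℝ) • x)
    (by rw [norm_smul, norm_inv, norm_norm, inv_mul_cancel₀ (norm_ne_zero_iff.2 h0)])
    (b := ‖x‖) (pow_le_one₀ (norm_nonneg _) hx)
  refine le_trans (le_of_eq ?_) h
  refine lintegral_congr fun ω => ?_
  congr 4
  rw [Finset.mul_sum]
  refine Finset.sum_congr rfl fun i _ => ?_
  rw [real_inner_smul_left, mul_pow, ← mul_assoc, inv_pow,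
    mul_inv_cancel₀ (by simpa using h0), one_mul]

end Data

/-! ### Perturbation of a direction and arithmetic of the sample threshold -/

/-- Termwise `(p + q)² ≤ (17/16) p² + 17 q²`, and `17/32 + 17/1024 = 561/1024`, only slightly above
one half. -/
lemma sum_inner_sq_perturb {d n : ℕ} {v : Fin n → Vec d} (hv : ∀ i, ‖v i‖ ≤ 1) {t : ℝ}
    (ht : 0 ≤ t) {x₀ x : Vec d} (h0 : ∑ i, (inner ℝ x₀ (v i)) ^ 2 ≤ t * n / 2)
    (hx : ‖x - x₀‖ ≤ √t / 32) :
    ∑ i, (inner ℝ x (v i)) ^ 2 ≤ 561 / 1024 * (t * n) := by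
  have key : ∀ i, (inner ℝ x (v i)) ^ 2 ≤ 17 / 16 * (inner ℝ x₀ (v i)) ^ 2 + 17 * (t / 1024) := by
    intro i
    have h1 : inner ℝ x (v i) = inner ℝ x₀ (v i) + inner ℝ (x - x₀) (v i) := by
      rw [inner_sub_left]; ring
    have h2 : (inner ℝ (x - x₀) (v i)) ^ 2 ≤ t / 1024 := by
      have h3 : |inner ℝ (x - x₀) (v i)| ≤ √t / 32 :=
        (abs_real_inner_le_norm _ _).trans
          ((mul_le_of_le_one_right (norm_nonneg _) (hv i)).trans hx)
      calc (inner ℝ (x - x₀) (v i)) ^ 2 = |inner ℝ (x - x₀) (v i)| ^ 2 := (sq_abs _).symm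
        _ ≤ (√t / 32) ^ 2 := by gcongr
        _ = t / 1024 := by rw [div_pow, Real.sq_sqrt ht]; norm_num
    rw [h1]
    nlinarith [sq_nonneg ((inner ℝ x₀ (v i) : ℝ) - 16 * inner ℝ (x - x₀) (v i))]
  calc ∑ i, (inner ℝ x (v i)) ^ 2
      ≤ ∑ i, (17 / 16 * (inner ℝ x₀ (v i)) ^ 2 + 17 * (t / 1024)) :=
        Finset.sum_le_sum fun i _ => key i
    _ = 17 / 16 * ∑ i, (inner ℝ x₀ (v i)) ^ 2 + n * (17 * (t / 1024)) := by
        rw [Finset.sum_add_distrib, ← Finset.mul_sum]; simp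
    _ ≤ _ := by linarith

lemma log_sample_argument {U d : ℕ} (hU : 0 < U) (hd : 0 < d) {t δ : ℝ} (ht : 0 < t)
    (hδ : 0 < δ) :
    Real.log (8 * U * d / (t ^ 2 * δ))
      = 3 * Real.log 2 + Real.log (U / δ) + Real.log d + 2 * -Real.log t := by
  have : (0 : ℝ) < U := by exact_mod_cast hU
  have : (0 : ℝ) < d := by exact_mod_cast hd
  have h8 : Real.log 8 = 3 * Real.log 2 := by
    rw [show (8 : ℝ) = 2 ^ 3 by norm_num, Real.log_pow]; norm_num
  rw [Real.log_div (by positivity) (by positivity), Real.log_mul (by positivity) (by positivity),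
    Real.log_mul (by positivity) (by positivity), Real.log_mul (by positivity) (by positivity),
    Real.log_pow, h8, Real.log_div (by positivity) (by positivity)]
  push_cast; ring

lemma log_two_mul_card_div {U : ℕ} (hU : 0 < U) {δ : ℝ} (hδ : δ ∈ Set.Ioo (0 : ℝ) 1) :
    0 ≤ Real.log (U / δ) ∧ Real.log (2 * U / δ) = Real.log 2 + Real.log (U / δ) := by
  have h1 : (1 : ℝ) ≤ U := by exact_mod_cast hU
  have := hδ.1
  refine ⟨Real.log_nonneg ?_, ?_⟩
  · rw [le_div_iff₀ hδ.1]; linarith [hδ.2]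
  · rw [mul_div_assoc, Real.log_mul (by norm_num) (by positivity)]

/-- The threshold carries `1/t²`: one factor `1/t` is cancelled by `t * n`, the other dominates `d`.
-/
lemma sample_size_bound {U d : ℕ} (hU : 0 < U) (hd : 0 < d) {t δ n : ℝ} (ht : 0 < t)
    (htd : d * t ≤ 1) (hδ : δ ∈ Set.Ioo (0 : ℝ) 1)
    (hn : 16 / t ^ 2 * Real.log (8 * U * d / (t ^ 2 * δ)) ≤ n) :
    16 * (d * (3 * Real.log 2 + Real.log (U / δ) + Real.log d + 2 * -Real.log t)) ≤ t * n ∧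
      Real.log d ≤ -Real.log t := by
  have hd' : (1 : ℝ) ≤ d := by exact_mod_cast hd
  have hl2 := Real.log_pos (show (1 : ℝ) < 2 by norm_num)
  have hy := (log_two_mul_card_div hU hδ).1
  have hld : 0 ≤ Real.log d := Real.log_nonneg hd'
  have hdt : (d : ℝ) ≤ 1 / t := by rwa [le_div_iff₀ ht]
  have hlt : Real.log d ≤ -Real.log t := by
    rw [← Real.log_inv]
    exact Real.log_le_log (by positivity) (by rwa [← one_div])
  refine ⟨?_, hlt⟩
  rw [log_sample_argument hU hd ht hδ.1] at hn
  set L := 3 * Real.log 2 + Real.log (U / δ) + Real.log d + 2 * -Real.log t with hL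
  have hL0 : 0 ≤ L := by rw [hL]; linarith
  calc 16 * (d * L) ≤ 16 * (1 / t * L) := by gcongr
    _ = t * (16 / t ^ 2 * L) := by field_simp
    _ ≤ t * n := by gcongr

/-- The loss `64^d` costs `6 d log 2`; it is covered using `log 2 ≤ log d ≤ -log t`, which is where
`2 ≤ d` enters. -/
lemma exp_neg_le_of_two_le {U d : ℕ} (hU : 0 < U) (hd : 2 ≤ d) {t δ n : ℝ} (ht : 0 < t)
    (htd : d * t ≤ 1) (hδ : δ ∈ Set.Ioo (0 : ℝ) 1)
    (hn : 16 / t ^ 2 * Real.log (8 * U * d / (t ^ 2 * δ)) ≤ n) :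
    Real.exp (-(5 / 64 * (t * n))) ≤ (√t / 64) ^ d * (δ / (2 * U)) := by
  obtain ⟨h1, hlt⟩ := sample_size_bound hU (by omega) ht htd hδ hn
  obtain ⟨hy, h2⟩ := log_two_mul_card_div hU hδ
  have hd' : (2 : ℝ) ≤ d := by exact_mod_cast hd
  have hU' : (0 : ℝ) < U := by exact_mod_cast hU
  have hst : 0 < √t := Real.sqrt_pos.2 ht
  have hδ0 := hδ.1
  have hl2 := Real.log_pos (show (1 : ℝ) < 2 by norm_num)
  have hld : Real.log 2 ≤ Real.log d := Real.log_le_log (by norm_num) hd'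
  have h64 : Real.log 64 = 6 * Real.log 2 := by
    rw [show (64 : ℝ) = 2 ^ 6 by norm_num, Real.log_pow]; norm_num
  rw [← Real.exp_log (show 0 < (√t / 64) ^ d * (δ / (2 * U)) by positivity), Real.exp_le_exp,
    Real.log_mul (by positivity) (by positivity), Real.log_pow,
    Real.log_div (by positivity) (by positivity), Real.log_sqrt ht.le, h64,
    show δ / (2 * U) = (2 * U / δ)⁻¹ by rw [inv_div], Real.log_inv, h2]
  have e1 : (d : ℝ) * Real.log 2 ≤ d * Real.log d := by gcongr
  have e2 : (d : ℝ) * Real.log d ≤ d * -Real.log t := by gcongr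
  have e3 : 2 * Real.log 2 ≤ d * Real.log 2 := by gcongr
  have e4 : 2 * Real.log (U / δ) ≤ d * Real.log (U / δ) := by gcongr
  linarith

lemma exp_neg_le_of_one {U : ℕ} (hU : 0 < U) {t δ n : ℝ} (ht : 0 < t)
    (htd : t ≤ 1) (hδ : δ ∈ Set.Ioo (0 : ℝ) 1)
    (hn : 16 / t ^ 2 * Real.log (8 * U * (1 : ℕ) / (t ^ 2 * δ)) ≤ n) :
    Real.exp (-(3 / 25 * (t * n))) ≤ δ / (2 * U) := by
  obtain ⟨h1, hlt⟩ := sample_size_bound hU one_pos ht (by simpa using htd) hδ hn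
  obtain ⟨hy, h2⟩ := log_two_mul_card_div hU hδ
  have hU' : (0 : ℝ) < U := by exact_mod_cast hU
  have hδ0 := hδ.1
  have hl2 := Real.log_pos (show (1 : ℝ) < 2 by norm_num)
  rw [← Real.exp_log (show 0 < δ / (2 * U) by positivity), Real.exp_le_exp,
    show δ / (2 * U) = (2 * U / δ)⁻¹ by rw [inv_div], Real.log_inv, h2]
  simp only [Nat.cast_one, Real.log_one, one_mul] at h1 hlt
  linarith

/-! ### From one direction to all directions -/

section Data

variable {Ω : Type*} [mΩ : MeasurableSpace Ω] {P : Measure Ω}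
  {ι : Type*} {N : ι → ℕ} {d : ℕ} {ρ : Measure (Vec d)} {lamA σ : ℝ} {S : ℕ}
  {R : ι → Kernel (Vec d) ℝ} {K : (u : ι) → Fin (N u) → ℕ}
  {X : (u : ι) → (i : Fin (N u)) → Fin (K u i) → Ω → Vec d}
  {a : (u : ι) → Fin (N u) → Ω → Vec d} {r : (u : ι) → Fin (N u) → Ω → ℝ}

lemma IsOfflineData.measurable_exp_neg_sum (hdata : IsOfflineData P ρ S R K X a r) (u : ι) :
    Measurable fun q : Ω × Vec d =>
      ENNReal.ofReal (Real.exp (-(2 / 5 * ∑ i, (inner ℝ q.2 (a u i q.1)) ^ 2))) := by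
  have : ∀ i, Measurable fun q : Ω × Vec d => a u i q.1 := fun i =>
    (hdata.measurable_action u i).comp measurable_fst
  have : ∀ i, Measurable fun q : Ω × Vec d => (inner ℝ q.2 (a u i q.1) : ℝ) := fun i =>
    measurable_snd.inner (this i)
  fun_prop

variable [IsProbabilityMeasure P]

lemma IsOfflineData.measure_sum_inner_sq_le (hdata : IsOfflineData P ρ S R K X a r)
    (hρ : ActionRegularity ρ lamA σ) (u : ι) {x : Vec d} (hx : ‖x‖ = 1) :
    P {ω | ∑ i, (inner ℝ x (a u i ω)) ^ 2 ≤ smoothedParam lamA σ S * N u / 2}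
      ≤ ENNReal.ofReal (Real.exp (-(3 / 25 * (smoothedParam lamA σ S * N u)))) := by
  have hE := hdata.lintegral_exp_neg_sum hρ u hx.le
  rw [hx] at hE
  have hm : Measurable fun ω =>
      ENNReal.ofReal (Real.exp (-(2 / 5 * ∑ i, (inner ℝ x (a u i ω)) ^ 2))) := by
    have := hdata.measurable_action u
    fun_prop
  generalize smoothedParam lamA σ S = t at *
  have h := meas_ge_le_lintegral_div (μ := P) hm.aemeasurable
    (ε := ENNReal.ofReal (Real.exp (-(1 / 5 * (t * N u))))) (by simp [Real.exp_pos]) (by simp)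
  refine (measure_mono fun ω hω => ?_).trans (h.trans (le_trans (ENNReal.div_le_div_right hE _) ?_))
  · simp only [Set.mem_ofPred_eq] at hω ⊢
    -- Markov's inequality at half the mean: the resulting exponent is `8/25 - 1/5 = 3/25`.
    refine ENNReal.ofReal_le_ofReal (Real.exp_le_exp.2 ?_)
    linarith
  · rw [← ENNReal.ofReal_div_of_pos (Real.exp_pos _), ← Real.exp_sub]
    refine ENNReal.ofReal_le_ofReal (Real.exp_le_exp.2 ?_)
    linarith

/-- Volume comparison: a direction in which the actions explore little is surrounded by a ball of
such directions, so the bound for a fixed direction can be averaged over directions. -/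
lemma IsOfflineData.measure_exists_sum_inner_sq_le (hdata : IsOfflineData P ρ S R K X a r)
    (hρ : ActionRegularity ρ lamA σ) (u : ι) (hd : 0 < d) (ht : 0 < smoothedParam lamA σ S) :
    ENNReal.ofReal ((√(smoothedParam lamA σ S) / 64) ^ d) *
      P {ω | ∃ x : Vec d, ‖x‖ = 1 ∧
        ∑ i, (inner ℝ x (a u i ω)) ^ 2 ≤ smoothedParam lamA σ S * N u / 2}
      ≤ ENNReal.ofReal (Real.exp (-(5 / 64 * (smoothedParam lamA σ S * N u)))) := by
  have ht1 : smoothedParam lamA σ S ≤ 1 := by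
    have h1 := smoothedParam_le hρ.lamA_pos.le σ S
    have h2 := hρ.mul_lamA_le_one
    have h3 : (1 : ℝ) ≤ d := by exact_mod_cast hd
    nlinarith [hρ.lamA_pos]
  have hmom := fun x : Vec d => fun hx : ‖x‖ ≤ 1 => hdata.lintegral_exp_neg_sum hρ u hx
  generalize smoothedParam lamA σ S = t at *
  set B : ℝ≥0∞ := volume (Metric.closedBall (0 : Vec d) 1) with hB
  have hB0 : B ≠ 0 := (Metric.measure_closedBall_pos volume _ one_pos).ne'
  have hBt : B ≠ ⊤ := measure_closedBall_lt_top.ne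
  set ε : ℝ := √t / 64 with hε
  have hst : 0 < √t := Real.sqrt_pos.2 ht
  have hst1 : √t ≤ 1 := Real.sqrt_le_one.2 ht1
  have hε0 : 0 < ε := by positivity
  have hε1 : ε ≤ 1 / 64 := by rw [hε]; linarith
  -- A shell instead of the ball: the moment bound weakens with `‖x‖`, and on the shell its exponent
  -- is still `8/25 * 15/16 = 3/10`.
  set A : Set (Vec d) := {x | ‖x‖ ≤ 1 ∧ 15 / 16 ≤ ‖x‖ ^ 2} with hA
  have hAm : MeasurableSet A :=
    (measurableSet_le measurable_norm measurable_const).inter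
      (measurableSet_le measurable_const (measurable_norm.pow_const 2))
  have hAB : volume A ≤ B := measure_mono fun x hx => by simpa using hx.1
  set Φ : Ω → Vec d → ℝ≥0∞ := fun ω x =>
    ENNReal.ofReal (Real.exp (-(2 / 5 * ∑ i, (inner ℝ x (a u i ω)) ^ 2))) with hΦ
  have hΦm : Measurable (Function.uncurry Φ) := hdata.measurable_exp_neg_sum u
  have hF : Measurable fun ω => ∫⁻ x in A, Φ ω x := hΦm.lintegral_prod_right'
  have hE : ∫⁻ ω, (∫⁻ x in A, Φ ω x) ∂P ≤ ENNReal.ofReal (Real.exp (-(3 / 10 * (t * N u)))) * B := by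
    rw [lintegral_lintegral_swap hΦm.aemeasurable]
    calc ∫⁻ x in A, (∫⁻ ω, Φ ω x ∂P)
        ≤ ∫⁻ _ in A, ENNReal.ofReal (Real.exp (-(3 / 10 * (t * N u)))) := by
          refine setLIntegral_mono' hAm fun x hx => (hmom x hx.1).trans ?_
          refine ENNReal.ofReal_le_ofReal (Real.exp_le_exp.2 ?_)
          have := mul_le_mul_of_nonneg_left hx.2 (show 0 ≤ t * N u by positivity)
          nlinarith
      _ ≤ _ := by rw [setLIntegral_const]; gcongr
  set θ₀ : ℝ≥0∞ := ENNReal.ofReal (Real.exp (-(2 / 5 * (561 / 1024 * (t * N u))))) with hθ₀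
  have hsub : {ω | ∃ x : Vec d, ‖x‖ = 1 ∧ ∑ i, (inner ℝ x (a u i ω)) ^ 2 ≤ t * N u / 2}
      ≤ᵐ[P] {ω | θ₀ * (ENNReal.ofReal (ε ^ d) * B) ≤ ∫⁻ x in A, Φ ω x} := by
    filter_upwards [hdata.norm_action_le hρ.norm_le_one u] with ω hω
    rintro ⟨x₀, hx₀, hsum⟩
    -- The ball touches the unit sphere from inside at `x₀`. It stays in the unit ball, and its
    -- points have norm at least `1 - 2ε ≥ 31/32`, whose square exceeds 15/16.
    have hball : ∀ x ∈ Metric.closedBall ((1 - ε) • x₀) ε,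
        x ∈ A ∧ ‖x - x₀‖ ≤ √t / 32 := by
      intro x hx
      rw [Metric.mem_closedBall, dist_eq_norm] at hx
      have hc : ‖(1 - ε) • x₀‖ = 1 - ε := by
        rw [norm_smul, hx₀, mul_one, Real.norm_eq_abs, abs_of_nonneg (by linarith)]
      have hc' : ‖(1 - ε) • x₀ - x₀‖ = ε := by
        rw [show (1 - ε) • x₀ - x₀ = (-ε) • x₀ by rw [sub_smul, one_smul, neg_smul]; abel,
          norm_smul, hx₀, mul_one, norm_neg, Real.norm_eq_abs, abs_of_pos hε0]
      have h1 : ‖x‖ ≤ 1 := by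
        have := norm_le_norm_add_norm_sub' x ((1 - ε) • x₀); linarith
      have h2 : ‖x - x₀‖ ≤ 2 * ε := by
        have := norm_sub_le_norm_sub_add_norm_sub x ((1 - ε) • x₀) x₀; linarith
      have h3 : 1 - 2 * ε ≤ ‖x‖ := by
        have := norm_le_norm_add_norm_sub x x₀; linarith
      refine ⟨⟨h1, ?_⟩, by rw [hε] at h2; linarith⟩
      nlinarith
    have hvol : volume (Metric.closedBall ((1 - ε) • x₀) ε) = ENNReal.ofReal (ε ^ d) * B := by
      rw [Measure.addHaar_closedBall' _ _ hε0.le]; simp [hB]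
    calc θ₀ * (ENNReal.ofReal (ε ^ d) * B)
        = ∫⁻ _ in Metric.closedBall ((1 - ε) • x₀) ε, θ₀ := by rw [setLIntegral_const, hvol]
      _ ≤ ∫⁻ x in Metric.closedBall ((1 - ε) • x₀) ε, Φ ω x := by
          refine setLIntegral_mono' measurableSet_closedBall fun x hx => ?_
          refine ENNReal.ofReal_le_ofReal (Real.exp_le_exp.2 ?_)
          have := sum_inner_sq_perturb hω ht.le hsum (hball x hx).2
          linarith
      _ ≤ _ := lintegral_mono_set fun x hx => (hball x hx).1
  have hmain := (mul_meas_ge_le_lintegral (μ := P) hF (θ₀ * (ENNReal.ofReal (ε ^ d) * B))).trans hE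
  have hmain2 : (θ₀ * (ENNReal.ofReal (ε ^ d)
      * P {ω | ∃ x : Vec d, ‖x‖ = 1 ∧ ∑ i, (inner ℝ x (a u i ω)) ^ 2 ≤ t * N u / 2})) * B
      ≤ ENNReal.ofReal (Real.exp (-(3 / 10 * (t * N u)))) * B := by
    refine le_trans ?_ hmain
    calc _ = θ₀ * (ENNReal.ofReal (ε ^ d) * B) * P {ω | ∃ x : Vec d, ‖x‖ = 1 ∧
            ∑ i, (inner ℝ x (a u i ω)) ^ 2 ≤ t * N u / 2} := by ring
      _ ≤ _ := mul_le_mul' le_rfl (measure_mono_ae hsub)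
  rw [ENNReal.mul_le_mul_iff_left hB0 hBt, mul_comm θ₀,
    ← ENNReal.le_div_iff_mul_le (by simp [hθ₀, Real.exp_pos]) (by simp [hθ₀]), hθ₀,
      ← ENNReal.ofReal_div_of_pos (Real.exp_pos _), ← Real.exp_sub] at hmain2
  -- `3/10 - 2/5 * 561/1024 = 207/2560`, just above `5/64 = 200/2560`.
  refine hmain2.trans (ENNReal.ofReal_le_ofReal (Real.exp_le_exp.2 ?_))
  have : 0 ≤ t * N u := by positivity
  linarith

/-- With at least the prescribed number of samples, the actions of a user explore all directions
simultaneously. -/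
lemma IsOfflineData.measure_poor_exploration_le (hdata : IsOfflineData P ρ S R K X a r)
    (hρ : ActionRegularity ρ lamA σ) (u : ι) (hd : 0 < d) {U : ℕ} (hU : 0 < U) {δ : ℝ}
    (hδ : δ ∈ Set.Ioo (0 : ℝ) 1) {t : ℝ} (htS : t = smoothedParam lamA σ S) (ht : 0 < t)
    (hn : 16 / t ^ 2 * Real.log (8 * U * d / (t ^ 2 * δ)) ≤ N u) :
    P {ω | ∃ x : Vec d, ‖x‖ = 1 ∧ ∑ i, (inner ℝ x (a u i ω)) ^ 2 ≤ t * N u / 2}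
      ≤ ENNReal.ofReal (δ / (2 * U)) := by
  have htd : d * t ≤ 1 := by
    have h1 := smoothedParam_le hρ.lamA_pos.le σ S
    refine le_trans ?_ hρ.mul_lamA_le_one
    rw [htS]; gcongr
  -- In dimension one the volume loss would be too large, but the only unit vectors are `±1`, with
  -- equal energies, so the fixed-direction bound suffices.
  rcases (show 2 ≤ d ∨ d = 1 by omega) with hd2 | rfl
  · have h := hdata.measure_exists_sum_inner_sq_le hρ u hd (htS ▸ ht)
    rw [← htS] at h
    have hst : 0 < √t := Real.sqrt_pos.2 ht
    have h' := h.trans (ENNReal.ofReal_le_ofReal (exp_neg_le_of_two_le hU hd2 ht htd hδ hn))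
    rw [ENNReal.ofReal_mul (by positivity)] at h'
    exact (ENNReal.mul_le_mul_iff_right (by simp; positivity) (by simp)).1 h'
  · have he : ‖(EuclideanSpace.single 0 1 : Vec 1)‖ = 1 := by simp
    have h := hdata.measure_sum_inner_sq_le hρ u he
    rw [← htS] at h
    refine (measure_mono ?_).trans (h.trans (ENNReal.ofReal_le_ofReal
      (exp_neg_le_of_one hU ht (by simpa using htd) hδ hn)))
    rintro ω ⟨x, hx, hsum⟩
    refine le_trans (le_of_eq (Finset.sum_congr rfl fun i _ => ?_)) hsum
    have hx2 : (x 0) ^ 2 = 1 := by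
      have := EuclideanSpace.real_norm_sq_eq x
      simpa [hx] using this.symm
    simp [PiLp.inner_apply, mul_pow, hx2]

end Data

/-! ### Determinants and Gaussian integrals -/

open scoped MatrixOrder Matrix.Norms.L2Operator in
lemma exists_eq_transpose_mul_self {d : ℕ} {M : Matrix (Fin d) (Fin d) ℝ} (hM : M.PosSemidef) :
    ∃ B : Matrix (Fin d) (Fin d) ℝ, M = Bᵀ * B := by
  obtain ⟨B, hB⟩ := CStarAlgebra.nonneg_iff_eq_star_mul_self.mp hM.nonneg
  exact ⟨B, by rw [hB, Matrix.star_eq_conjTranspose, Matrix.conjTranspose_eq_transpose_of_trivial]⟩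

/-- The arithmetic-geometric mean inequality for the eigenvalues. -/
lemma det_le_trace_div_pow {d : ℕ} (hd : 0 < d) {M : Matrix (Fin d) (Fin d) ℝ}
    (hM : M.PosSemidef) : M.det ≤ (M.trace / d) ^ d := by
  have hd' : (0 : ℝ) < d := by exact_mod_cast hd
  have hnn := hM.eigenvalues_nonneg
  rw [hM.isHermitian.det_eq_prod_eigenvalues, hM.isHermitian.trace_eq_sum_eigenvalues]
  simp only [RCLike.ofReal_real_eq_id, id_eq]
  set z := hM.isHermitian.eigenvalues
  have h := Real.geom_mean_le_arith_mean_weighted Finset.univ (fun _ : Fin d => (d : ℝ)⁻¹) z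
    (fun _ _ => by positivity) (by simp [hd'.ne']) (fun i _ => hnn i)
  have h2 := pow_le_pow_left₀ (Finset.prod_nonneg fun i _ => Real.rpow_nonneg (hnn i) _) h d
  rw [← Finset.prod_pow] at h2
  calc ∏ i, z i = ∏ i, (z i ^ (d : ℝ)⁻¹) ^ d :=
        Finset.prod_congr rfl fun i _ => (Real.rpow_inv_natCast_pow (hnn i) hd.ne').symm
    _ ≤ _ := h2
    _ = _ := by rw [← Finset.mul_sum, div_eq_inv_mul]

/-- Factor `M = BᵀB` and substitute `y = Bx`. -/
lemma lintegral_exp_neg_quadratic {d : ℕ} {M : Matrix (Fin d) (Fin d) ℝ} (hM : M.PosDef) :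
    ∫⁻ x : Vec d, ENNReal.ofReal (Real.exp (-(1 / 2 * (x.ofLp ⬝ᵥ (M *ᵥ x.ofLp)))))
      = ENNReal.ofReal (√M.det)⁻¹ * ∫⁻ x : Vec d, ENNReal.ofReal (Real.exp (-(1 / 2 * ‖x‖ ^ 2))) := by
  obtain ⟨B, rfl⟩ := exists_eq_transpose_mul_self hM.posSemidef
  have hdet := hM.det_pos
  rw [Matrix.det_mul, Matrix.det_transpose] at hdet ⊢
  have hB : B.det ≠ 0 := by intro h; simp [h] at hdet
  set f : Vec d →ₗ[ℝ] Vec d := Matrix.toEuclideanLin B with hf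
  have hfdet : LinearMap.det f = B.det := LinearMap.det_toLpLin 2 B
  have hmap := Measure.map_linearMap_addHaar_eq_smul_addHaar (volume : Measure (Vec d))
    (f := f) (by rwa [hfdet])
  have hquad : ∀ x : Vec d, x.ofLp ⬝ᵥ ((Bᵀ * B) *ᵥ x.ofLp) = ‖f x‖ ^ 2 := by
    intro x
    rw [← Matrix.mulVec_mulVec, Matrix.dotProduct_mulVec, Matrix.vecMul_transpose,
      EuclideanSpace.real_norm_sq_eq, dotProduct]
    simp [f, Matrix.toLpLin_apply, sq]
  have hg : Measurable fun y : Vec d => ENNReal.ofReal (Real.exp (-(1 / 2 * ‖y‖ ^ 2))) := by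
    fun_prop
  have hfm : Measurable f := f.continuous_of_finiteDimensional.measurable
  simp_rw [hquad]
  rw [← lintegral_map hg hfm, hmap, lintegral_smul_measure, hfdet, smul_eq_mul, abs_inv,
    Real.sqrt_mul_self_eq_abs]

/-- The Gaussian constant cancels in the mixture argument, so its value is irrelevant. -/
lemma lintegral_gaussian_pos (d : ℕ) :
    ∫⁻ x : Vec d, ENNReal.ofReal (Real.exp (-(1 / 2 * ‖x‖ ^ 2))) ≠ 0 ∧
      ∫⁻ x : Vec d, ENNReal.ofReal (Real.exp (-(1 / 2 * ‖x‖ ^ 2))) ≠ ⊤ := by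
  constructor
  · refine (lintegral_pos_iff_support (by fun_prop)).2 ?_ |>.ne'
    have : Function.support (fun x : Vec d => ENNReal.ofReal (Real.exp (-(1 / 2 * ‖x‖ ^ 2))))
        = Set.univ := by
      ext x; simp [Real.exp_pos]
    rw [this]
    exact isOpen_univ.measure_pos _ ⟨0, trivial⟩
  · have h := (GaussianFourier.integrable_cexp_neg_mul_sq_norm_add (V := Vec d)
      (b := 1 / 2) (by norm_num) 0 0).norm
    have h2 : Integrable (fun x : Vec d => Real.exp (-(1 / 2 * ‖x‖ ^ 2))) := by
      refine h.congr (Filter.Eventually.of_forall fun x => ?_)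
      simp only [Complex.norm_exp]
      congr 1
      have : (-(1 / 2 : ℂ) * (‖x‖ : ℂ) ^ 2 + 0 * ((inner ℝ (0 : Vec d) x : ℝ) : ℂ))
          = ((-(1 / 2 * ‖x‖ ^ 2) : ℝ) : ℂ) := by push_cast; ring
      rw [this, Complex.ofReal_re]
    rw [← ofReal_integral_eq_lintegral_ofReal h2
      (Filter.Eventually.of_forall fun x => (Real.exp_pos _).le)]
    exact ENNReal.ofReal_ne_top

/-- Completing the square. -/
lemma lintegral_exp_inner_sub_quadratic {d : ℕ} {M : Matrix (Fin d) (Fin d) ℝ} (hM : M.PosDef)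
    {s w : Vec d} (hw : M *ᵥ w.ofLp = s.ofLp) :
    ∫⁻ x : Vec d, ENNReal.ofReal (Real.exp (inner ℝ x s - 1 / 2 * (x.ofLp ⬝ᵥ (M *ᵥ x.ofLp))))
      = ENNReal.ofReal (Real.exp (1 / 2 * inner ℝ w s)) * (ENNReal.ofReal (√M.det)⁻¹ *
        ∫⁻ x : Vec d, ENNReal.ofReal (Real.exp (-(1 / 2 * ‖x‖ ^ 2)))) := by
  have hin : ∀ x y : Vec d, inner ℝ x y = x.ofLp ⬝ᵥ y.ofLp := fun x y => by
    simp [EuclideanSpace.inner_eq_star_dotProduct, dotProduct_comm]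
  have hsymm : ∀ x : Vec d, w.ofLp ⬝ᵥ (M *ᵥ x.ofLp) = x.ofLp ⬝ᵥ s.ofLp := by
    intro x
    have hT : Mᵀ = M := by
      rw [← Matrix.conjTranspose_eq_transpose_of_trivial]; exact hM.isHermitian
    rw [Matrix.dotProduct_mulVec, ← Matrix.mulVec_transpose, hT, hw, dotProduct_comm]
  rw [← lintegral_exp_neg_quadratic hM,
    ← lintegral_sub_right_eq_self (fun x : Vec d =>
      ENNReal.ofReal (Real.exp (-(1 / 2 * (x.ofLp ⬝ᵥ (M *ᵥ x.ofLp)))))) w,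
    ← lintegral_const_mul _ (by
      have : Continuous fun x : Vec d => M *ᵥ x.ofLp := by fun_prop
      have h2 : Continuous fun x : Vec d => x.ofLp ⬝ᵥ (M *ᵥ x.ofLp) := by
        unfold dotProduct; fun_prop
      refine ENNReal.measurable_ofReal.comp (Real.measurable_exp.comp ?_)
      have h3 : Continuous fun x : Vec d => (x - w).ofLp ⬝ᵥ (M *ᵥ (x - w).ofLp) :=
        h2.comp (continuous_id.sub continuous_const)
      exact ((h3.measurable).const_mul _).neg)]
  refine lintegral_congr fun x => ?_
  rw [← ENNReal.ofReal_mul (Real.exp_nonneg _), ← Real.exp_add]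
  congr 2
  rw [WithLp.ofLp_sub, Matrix.mulVec_sub, sub_dotProduct, dotProduct_sub, dotProduct_sub, hsymm x,
    hw, hin, hin]
  ring

/-! ### The regularised Gram matrix -/

section Gram

variable {ι : Type*} {N : ι → ℕ} {d : ℕ}

lemma gram_mulVec (lam : ℝ) (D : Dataset ι N d) (u : ι) (x : Vec d) :
    gram lam D u *ᵥ x.ofLp
      = (lam • x + ∑ i, (inner ℝ (D u i).1 x : ℝ) • (D u i).1).ofLp := by
  simp only [gram, Matrix.add_mulVec, Matrix.smul_mulVec, Matrix.one_mulVec, Matrix.sum_mulVec,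
    WithLp.ofLp_add, WithLp.ofLp_smul, WithLp.ofLp_sum]
  congr 1
  refine Finset.sum_congr rfl fun i _ => ?_
  rw [Matrix.vecMulVec_mulVec]
  ext j
  simp [EuclideanSpace.inner_eq_star_dotProduct, dotProduct_comm, mul_comm]

lemma gram_quadratic (lam : ℝ) (D : Dataset ι N d) (u : ι) (x : Vec d) :
    x.ofLp ⬝ᵥ (gram lam D u *ᵥ x.ofLp)
      = lam * ‖x‖ ^ 2 + ∑ i, (inner ℝ x (D u i).1) ^ 2 := by
  have hin : ∀ x y : Vec d, x.ofLp ⬝ᵥ y.ofLp = inner ℝ x y := fun x y => by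
    simp [EuclideanSpace.inner_eq_star_dotProduct, dotProduct_comm]
  rw [gram_mulVec, hin, inner_add_right, inner_smul_right, real_inner_self_eq_norm_sq, inner_sum]
  congr 1
  refine Finset.sum_congr rfl fun i _ => ?_
  rw [inner_smul_right, real_inner_comm, sq]

lemma gram_posDef {lam : ℝ} (hlam : 0 < lam) (D : Dataset ι N d) (u : ι) :
    (gram lam D u).PosDef := by
  refine Matrix.PosDef.of_dotProduct_mulVec_pos ?_ fun {x} hx => ?_
  · ext i j
    simp [gram, Matrix.sum_apply, Matrix.vecMulVec_apply, Matrix.one_apply, mul_comm, eq_comm]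
  · have h := gram_quadratic lam D u (WithLp.toLp 2 x)
    simp only [star_trivial]
    rw [h]
    have : 0 < ‖WithLp.toLp 2 x‖ := norm_pos_iff.2 (by simpa using hx)
    have : 0 ≤ ∑ i, (inner ℝ (WithLp.toLp 2 x) (D u i).1 : ℝ) ^ 2 :=
      Finset.sum_nonneg fun i _ => sq_nonneg _
    positivity

lemma gram_det_le {lam : ℝ} (hlam : 0 < lam) (hd : 0 < d) (D : Dataset ι N d) (u : ι)
    (hD : ∀ i, ‖(D u i).1‖ ≤ 1) : (gram lam D u).det ≤ (lam * (1 + N u / (lam * d))) ^ d := by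
  have hd' : (0 : ℝ) < d := by exact_mod_cast hd
  refine (det_le_trace_div_pow hd (gram_posDef hlam D u).posSemidef).trans ?_
  have htr : (gram lam D u).trace = lam * d + ∑ i, ‖(D u i).1‖ ^ 2 := by
    simp [gram, Matrix.trace_add, Matrix.trace_sum, Matrix.trace_vecMulVec, dotProduct]
    refine Finset.sum_congr rfl fun i _ => ?_
    rw [EuclideanSpace.real_norm_sq_eq]
    simp [sq]
  have hs : ∑ i, ‖(D u i).1‖ ^ 2 ≤ N u := by
    calc ∑ i, ‖(D u i).1‖ ^ 2 ≤ ∑ _i : Fin (N u), (1 : ℝ) :=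
          Finset.sum_le_sum fun i _ => pow_le_one₀ (norm_nonneg _) (hD i)
      _ = N u := by simp
  refine pow_le_pow_left₀ ?_ ?_ d
  · rw [htr]; positivity
  · rw [htr, div_le_iff₀ hd']
    have : lam * (1 + N u / (lam * d)) * d = lam * d + N u := by field_simp
    linarith

end Gram

/-! ### Self-normalised noise -/

lemma RewardModel.lintegral_exp_le {ι : Type*} {d : ℕ} {θ : ι → Vec d}
    {R : ι → Kernel (Vec d) ℝ} (hR : RewardModel θ R) (u : ι) {b : Vec d} (hb : ‖b‖ ≤ 1) (y : ℝ) :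
    ∫⁻ z, ENNReal.ofReal (Real.exp (y * (z - inner ℝ (θ u) b) - 1 / 2 * y ^ 2)) ∂(R u b) ≤ 1 := by
  have h := hR.subgaussian u b hb
  have hmgf := h.mgf_le y
  have hint := h.integrable_exp_mul y
  rw [mgf] at hmgf
  calc ∫⁻ z, ENNReal.ofReal (Real.exp (y * (z - inner ℝ (θ u) b) - 1 / 2 * y ^ 2)) ∂(R u b)
      = ∫⁻ z, ENNReal.ofReal (Real.exp (-(1 / 2 * y ^ 2)))
          * ENNReal.ofReal (Real.exp (y * (z - inner ℝ (θ u) b))) ∂(R u b) := by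
        refine lintegral_congr fun z => ?_
        rw [← ENNReal.ofReal_mul (Real.exp_nonneg _), ← Real.exp_add]
        congr 2; ring
    _ = ENNReal.ofReal (Real.exp (-(1 / 2 * y ^ 2)))
          * ENNReal.ofReal (∫ z, Real.exp (y * (z - inner ℝ (θ u) b)) ∂(R u b)) := by
        rw [lintegral_const_mul _ (by fun_prop), ofReal_integral_eq_lintegral_ofReal hint
          (Filter.Eventually.of_forall fun z => (Real.exp_pos _).le)]
    _ ≤ ENNReal.ofReal (Real.exp (-(1 / 2 * y ^ 2)))
          * ENNReal.ofReal (Real.exp ((1 : ℝ≥0) * y ^ 2 / 2)) := by gcongr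
    _ = 1 := by
        rw [← ENNReal.ofReal_mul (Real.exp_nonneg _), ← Real.exp_add]
        simp only [NNReal.coe_one]
        rw [show -(1 / 2 * y ^ 2) + 1 * y ^ 2 / 2 = 0 by ring]
        simp

section Data

variable {Ω : Type*} [mΩ : MeasurableSpace Ω] {P : Measure Ω} [IsProbabilityMeasure P]
  {ι : Type*} {N : ι → ℕ} {d : ℕ} {ρ : Measure (Vec d)} {lamA σ : ℝ} {S : ℕ} {θ : ι → Vec d}
  {R : ι → Kernel (Vec d) ℝ} {K : (u : ι) → Fin (N u) → ℕ}
  {X : (u : ι) → (i : Fin (N u)) → Fin (K u i) → Ω → Vec d}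
  {a : (u : ι) → Fin (N u) → Ω → Vec d} {r : (u : ι) → Fin (N u) → Ω → ℝ}

/-- The reward law as a disintegration of the joint law of a weight, the action and the reward. -/
lemma IsOfflineData.lintegral_reward (hdata : IsOfflineData P ρ S R K X a r)
    (hM : ∀ u, IsMarkovKernel (R u)) (u : ι) (i : Fin (N u)) {W : Ω → ℝ≥0∞}
    (hW : Measurable[history K X a r u i] W) {G : Vec d → ℝ → ℝ≥0∞}
    (hG : Measurable (Function.uncurry G)) :
    ∫⁻ ω, W ω * G (a u i ω) (r u i ω) ∂P = ∫⁻ ω, W ω * ∫⁻ z, G (a u i ω) z ∂(R u (a u i ω)) ∂P := by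
  have := hM u
  set V : Ω → ℝ≥0∞ × Vec d := fun ω => (W ω, a u i ω) with hV
  have hWm : Measurable W := hW.mono (hdata.history_le u i) le_rfl
  have ham := hdata.measurable_action u i
  have hrm := hdata.measurable_reward u i
  have hVm : Measurable V := hWm.prodMk ham
  have hVF : Measurable[history K X a r u i ⊔ (⨆ k, MeasurableSpace.comap (X u i k) inferInstance)
      ⊔ MeasurableSpace.comap (a u i) inferInstance] V :=
    Measurable.prodMk (hW.mono (le_sup_of_le_left le_sup_left) le_rfl)
      (measurable_iff_comap_le.2 le_sup_right)
  -- The kernel ignores the weight; the joint law is identified on rectangles, which is all that the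
  -- reward law describes.
  set κ : Kernel (ℝ≥0∞ × Vec d) ℝ := Kernel.comap (R u) Prod.snd measurable_snd with hκ
  have hjoint : P.map (fun ω => (V ω, r u i ω)) = (P.map V) ⊗ₘ κ := by
    have : IsProbabilityMeasure (P.map V) := Measure.isProbabilityMeasure_map hVm.aemeasurable
    have : IsFiniteMeasure (P.map (fun ω => (V ω, r u i ω))) := inferInstance
    refine Measure.ext_prod fun {s t} hs ht => ?_
    rw [Measure.map_apply (hVm.prodMk hrm) (hs.prod ht), Measure.compProd_apply_prod hs ht,
      setLIntegral_map hs (κ.measurable_coe ht) hVm]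
    have h := hdata.reward_law u i (V ⁻¹' s) (hVF hs) t ht
    rw [Set.mk_preimage_prod]
    exact h
  have hGm : Measurable fun q : (ℝ≥0∞ × Vec d) × ℝ => q.1.1 * G q.1.2 q.2 := by
    have : Measurable fun q : (ℝ≥0∞ × Vec d) × ℝ => G q.1.2 q.2 :=
      hG.comp ((measurable_snd.comp measurable_fst).prodMk measurable_snd)
    fun_prop
  calc ∫⁻ ω, W ω * G (a u i ω) (r u i ω) ∂P
      = ∫⁻ q, q.1.1 * G q.1.2 q.2 ∂(P.map (fun ω => (V ω, r u i ω))) := by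
        rw [lintegral_map hGm (hVm.prodMk hrm)]
    _ = ∫⁻ b, ∫⁻ z, b.1 * G b.2 z ∂(κ b) ∂(P.map V) := by
        rw [hjoint, Measure.lintegral_compProd hGm]
    _ = ∫⁻ ω, ∫⁻ z, W ω * G (a u i ω) z ∂(R u (a u i ω)) ∂P := by
        rw [lintegral_map (Measurable.lintegral_kernel_prod_right' hGm) hVm]
        rfl
    _ = _ := by
        refine lintegral_congr fun ω => lintegral_const_mul _ ?_
        exact hG.comp measurable_prodMk_left

/-- The exponential supermartingale of the noise in a fixed direction. -/
lemma IsOfflineData.lintegral_exp_noise_le (hdata : IsOfflineData P ρ S R K X a r)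
    (hb : ∀ᵐ a ∂ρ, ‖a‖ ≤ 1) (hR : RewardModel θ R) (u : ι) (x : Vec d) :
    ∫⁻ ω, ENNReal.ofReal (Real.exp (inner ℝ x (∑ i, (r u i ω - inner ℝ (θ u) (a u i ω)) • a u i ω)
      - 1 / 2 * ∑ i, (inner ℝ x (a u i ω)) ^ 2)) ∂P ≤ 1 := by
  set G : Vec d → ℝ → ℝ≥0∞ := fun b z => ENNReal.ofReal (Real.exp
    ((inner ℝ x b) * (z - inner ℝ (θ u) b) - 1 / 2 * (inner ℝ x b) ^ 2)) with hGdef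
  have hG : Measurable (Function.uncurry G) := by
    simp only [hGdef, Function.uncurry_def]; fun_prop
  have h := lintegral_prod_le_pow P (history K X a r u) (fun i ω => G (a u i ω) (r u i ω)) 1
    (fun i j hji => by
      have h1 : Measurable[history K X a r u i] (a u j) := measurable_action_history hji
      have h2 : Measurable[history K X a r u i] (r u j) := measurable_reward_history hji
      simp only [hGdef]
      fun_prop)
    (fun i W hW => by
      rw [hdata.lintegral_reward hR.isMarkov u i hW hG, one_mul]
      refine lintegral_mono_ae ?_
      filter_upwards [hdata.norm_action_le hb u] with ω hω
      exact mul_le_of_le_one_right' (hR.lintegral_exp_le u (hω i) _))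
  rw [one_pow] at h
  refine le_trans (le_of_eq (lintegral_congr fun ω => ?_)) h
  simp only [hGdef]
  rw [← ENNReal.ofReal_prod_of_nonneg fun _ _ => Real.exp_nonneg _, ← Real.exp_sum,
    Finset.sum_sub_distrib, ← Finset.mul_sum, inner_sum]
  simp only [inner_smul_right]
  simp only [mul_comm]

/-- Method of mixtures: the self-normalised noise is small with high probability. -/
lemma IsOfflineData.measure_self_normalized_gt_le (hdata : IsOfflineData P ρ S R K X a r)
    (hb : ∀ᵐ a ∂ρ, ‖a‖ ≤ 1) (hR : RewardModel θ R) (u : ι) (hd : 0 < d) {lam : ℝ} (hlam : 0 < lam)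
    {ε : ℝ} (hε : 0 < ε) :
    P {ω | ∃ w : Vec d,
      gram lam (fun u i => (a u i ω, r u i ω)) u *ᵥ w.ofLp
          = (∑ i, (r u i ω - inner ℝ (θ u) (a u i ω)) • a u i ω).ofLp ∧
        d * Real.log (1 + N u / (lam * d)) + 2 * Real.log (1 / ε)
          < inner ℝ w (∑ i, (r u i ω - inner ℝ (θ u) (a u i ω)) • a u i ω)} ≤ ENNReal.ofReal ε := by
  have hd' : (0 : ℝ) < d := by exact_mod_cast hd
  set D : Ω → Dataset ι N d := fun ω u i => (a u i ω, r u i ω) with hD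
  set s : Ω → Vec d := fun ω => ∑ i, (r u i ω - inner ℝ (θ u) (a u i ω)) • a u i ω with hs
  obtain ⟨hI0, hIt⟩ := lintegral_gaussian_pos d
  set I₀ : ℝ≥0∞ := ∫⁻ x : Vec d, ENNReal.ofReal (Real.exp (-(1 / 2 * ‖x‖ ^ 2))) with hI₀
  set Ψ : Ω → Vec d → ℝ≥0∞ := fun ω x => ENNReal.ofReal (Real.exp
    (inner ℝ x (s ω) - 1 / 2 * ∑ i, (inner ℝ x (a u i ω)) ^ 2 - 1 / 2 * (lam * ‖x‖ ^ 2))) with hΨ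
  have ham := hdata.measurable_action u
  have hrm := hdata.measurable_reward u
  have hsm : Measurable s := by fun_prop
  have hΨm : Measurable (Function.uncurry Ψ) := by
    have h1 : Measurable fun q : Ω × Vec d => s q.1 := hsm.comp measurable_fst
    have h2 : Measurable fun q : Ω × Vec d => (inner ℝ q.2 (s q.1) : ℝ) := measurable_snd.inner h1
    have h3 : ∀ i, Measurable fun q : Ω × Vec d => a u i q.1 := fun i =>
      (ham i).comp measurable_fst
    have h4 : ∀ i, Measurable fun q : Ω × Vec d => (inner ℝ q.2 (a u i q.1) : ℝ) := fun i =>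
      measurable_snd.inner (h3 i)
    simp only [hΨ, Function.uncurry_def]
    fun_prop
  have hlam_det : (lam • (1 : Matrix (Fin d) (Fin d) ℝ)).PosDef := Matrix.PosDef.one.smul hlam
  have hprior : ∫⁻ x : Vec d, ENNReal.ofReal (Real.exp (-(1 / 2 * (lam * ‖x‖ ^ 2))))
      = ENNReal.ofReal (√(lam ^ d))⁻¹ * I₀ := by
    have h := lintegral_exp_neg_quadratic hlam_det
    simp only [Matrix.det_smul, Matrix.det_one, mul_one, Fintype.card_fin, Matrix.smul_mulVec,
      Matrix.one_mulVec, dotProduct_smul, smul_eq_mul] at h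
    rw [← h]
    refine lintegral_congr fun x => ?_
    rw [EuclideanSpace.real_norm_sq_eq, dotProduct]
    simp [sq]
  have hE : ∫⁻ ω, (∫⁻ x, Ψ ω x) ∂P ≤ ENNReal.ofReal (√(lam ^ d))⁻¹ * I₀ := by
    rw [lintegral_lintegral_swap hΨm.aemeasurable, ← hprior]
    refine lintegral_mono fun x => ?_
    have h := hdata.lintegral_exp_noise_le hb hR u x
    calc ∫⁻ ω, Ψ ω x ∂P
        = ∫⁻ ω, ENNReal.ofReal (Real.exp (-(1 / 2 * (lam * ‖x‖ ^ 2)))) * ENNReal.ofReal (Real.exp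
          (inner ℝ x (s ω) - 1 / 2 * ∑ i, (inner ℝ x (a u i ω)) ^ 2)) ∂P := by
          refine lintegral_congr fun ω => ?_
          rw [← ENNReal.ofReal_mul (Real.exp_nonneg _), ← Real.exp_add]
          simp only [hΨ]
          congr 2; ring
      _ ≤ _ := by
          rw [lintegral_const_mul' _ _ ENNReal.ofReal_ne_top]
          exact mul_le_of_le_one_right' h
  set q : ℝ := 1 + N u / (lam * d) with hq
  have hq0 : 0 < q := by positivity
  -- On the bad event the mixture is at least `c * I₀`, by the determinant bound. Since `c =
  -- λ^(-d/2)/ε` and the mixture has mean at most `λ^(-d/2) * I₀`, Markov's inequality yields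
  -- exactly `ε`.
  set c : ℝ := (√((lam * q) ^ d))⁻¹ * (√(q ^ d) / ε) with hc
  have hc0 : 0 < c := by positivity
  have hsub : {ω | ∃ w : Vec d, gram lam (D ω) u *ᵥ w.ofLp = (s ω).ofLp ∧
        d * Real.log q + 2 * Real.log (1 / ε) < inner ℝ w (s ω)}
      ≤ᵐ[P] {ω | ENNReal.ofReal c * I₀ ≤ ∫⁻ x, Ψ ω x} := by
    filter_upwards [hdata.norm_action_le hb u] with ω hω
    rintro ⟨w, hw, hlt⟩
    have hdet := gram_det_le hlam hd (D ω) u hω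
    have hpd := gram_posDef hlam (D ω) u
    have heq : ∫⁻ x, Ψ ω x = ENNReal.ofReal (Real.exp (1 / 2 * inner ℝ w (s ω)))
        * (ENNReal.ofReal (√(gram lam (D ω) u).det)⁻¹ * I₀) := by
      rw [← lintegral_exp_inner_sub_quadratic hpd hw]
      refine lintegral_congr fun x => ?_
      rw [gram_quadratic]
      simp only [hΨ, hD]
      congr 2; ring
    show ENNReal.ofReal c * I₀ ≤ ∫⁻ x, Ψ ω x
    rw [heq, ← mul_assoc, ← ENNReal.ofReal_mul (Real.exp_nonneg _)]
    gcongr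
    rw [hc, mul_comm]
    have hsd : 0 < √(gram lam (D ω) u).det := Real.sqrt_pos.2 hpd.det_pos
    gcongr
    have : √(q ^ d) / ε = Real.exp (1 / 2 * (d * Real.log q + 2 * Real.log (1 / ε))) := by
      rw [← Real.exp_log (show 0 < √(q ^ d) / ε by positivity),
        Real.log_div (by positivity) hε.ne', Real.log_sqrt (by positivity), Real.log_pow, one_div ε,
        Real.log_inv]
      congr 1; ring
    rw [this]
    exact Real.exp_le_exp.2 (by linarith)
  have hF : Measurable fun ω => ∫⁻ x, Ψ ω x := hΨm.lintegral_prod_right'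
  have hmain := meas_ge_le_lintegral_div (μ := P) hF.aemeasurable
    (ε := ENNReal.ofReal c * I₀) (by simp [hI0, hc0]) (ENNReal.mul_ne_top (by simp) hIt)
  refine (measure_mono_ae hsub).trans (hmain.trans ((ENNReal.div_le_div_right hE _).trans ?_))
  rw [ENNReal.mul_div_mul_right _ _ hI0 hIt, ← ENNReal.ofReal_div_of_pos hc0]
  refine ENNReal.ofReal_le_ofReal (le_of_eq ?_)
  have h1 : 0 < √(lam ^ d) := by positivity
  have h2 : 0 < √(q ^ d) := by positivity
  rw [hc, mul_pow, Real.sqrt_mul (by positivity)]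
  field_simp

end Data

/-! ### Error of the ridge estimate -/

section Ridge

variable {ι : Type*} {N : ι → ℕ} {d : ℕ}

lemma gram_mulVec_inv_mulVec {lam : ℝ} (hlam : 0 < lam) (D : Dataset ι N d) (u : ι) (z : Vec d) :
    gram lam D u *ᵥ (WithLp.toLp 2 ((gram lam D u)⁻¹ *ᵥ z.ofLp) : Vec d).ofLp = z.ofLp := by
  have hdet : IsUnit (gram lam D u).det := (gram_posDef hlam D u).det_pos.ne'.isUnit
  rw [Matrix.mulVec_mulVec, Matrix.mul_nonsing_inv _ hdet, Matrix.one_mulVec]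

lemma gram_mulVec_ridge {lam : ℝ} (hlam : 0 < lam) (D : Dataset ι N d) (u : ι) :
    gram lam D u *ᵥ (ridge lam D u).ofLp = (moment D u).ofLp :=
  gram_mulVec_inv_mulVec hlam D u (moment D u)

lemma gram_mulVec_injective {lam : ℝ} (hlam : 0 < lam) (D : Dataset ι N d) (u : ι) {x y : Vec d}
    (h : gram lam D u *ᵥ x.ofLp = gram lam D u *ᵥ y.ofLp) : x = y := by
  have hdet : IsUnit (gram lam D u).det := (gram_posDef hlam D u).det_pos.ne'.isUnit
  have := congrArg ((gram lam D u)⁻¹ *ᵥ ·) h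
  simp only [Matrix.mulVec_mulVec, Matrix.nonsing_inv_mul _ hdet, Matrix.one_mulVec] at this
  exact (WithLp.ofLp_injective 2) this

lemma gram_mulVec_quadratic {lam : ℝ} (D : Dataset ι N d) (u : ι) {w z : Vec d}
    (h : gram lam D u *ᵥ w.ofLp = z.ofLp) :
    lam * ‖w‖ ^ 2 + ∑ i, (inner ℝ w (D u i).1) ^ 2 = inner ℝ w z := by
  rw [← gram_quadratic, h]
  simp [EuclideanSpace.inner_eq_star_dotProduct, dotProduct_comm]

lemma moment_eq (θ : Vec d) (D : Dataset ι N d) (u : ι) :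
    moment D u = ∑ i, ((D u i).2 - inner ℝ θ (D u i).1) • (D u i).1
      + ∑ i, (inner ℝ (D u i).1 θ : ℝ) • (D u i).1 := by
  rw [moment, ← Finset.sum_add_distrib]
  refine Finset.sum_congr rfl fun i _ => ?_
  rw [← add_smul, real_inner_comm, sub_add_cancel]

/-- The error of the ridge estimate, in terms of the self-normalised noise and of a lower bound for
the explored directions. -/
lemma norm_ridge_sub_le {lam : ℝ} (hlam : 0 < lam) (D : Dataset ι N d) (u : ι) {θ : Vec d}
    (hθ : ‖θ‖ ≤ 1) {c β : ℝ} (hc : 0 < c)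
    (hexp : ∀ x : Vec d, c * ‖x‖ ^ 2 ≤ ∑ i, (inner ℝ x (D u i).1) ^ 2)
    (hnoise : ∀ w : Vec d, gram lam D u *ᵥ w.ofLp
        = (∑ i, ((D u i).2 - inner ℝ θ (D u i).1) • (D u i).1).ofLp →
      inner ℝ w (∑ i, ((D u i).2 - inner ℝ θ (D u i).1) • (D u i).1) ≤ β) :
    ‖ridge lam D u - θ‖ ≤ (√β + √lam) / √c := by
  have hmom := moment_eq θ D u
  generalize (∑ i, ((D u i).2 - inner ℝ θ (D u i).1) • (D u i).1 : Vec d) = s at *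
  obtain ⟨w₁, h₁⟩ : ∃ w : Vec d, gram lam D u *ᵥ w.ofLp = s.ofLp :=
    ⟨_, gram_mulVec_inv_mulVec hlam D u s⟩
  obtain ⟨w₂, h₂⟩ : ∃ w : Vec d, gram lam D u *ᵥ w.ofLp = (lam • θ).ofLp :=
    ⟨_, gram_mulVec_inv_mulVec hlam D u (lam • θ)⟩
  -- Both sides have image `s - λθ` under the Gram matrix, because `Mθ = λθ + ∑ ⟨aᵢ, θ⟩ aᵢ`.
  have hdecomp : ridge lam D u - θ = w₁ - w₂ := by
    apply gram_mulVec_injective hlam D u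
    rw [WithLp.ofLp_sub, WithLp.ofLp_sub, Matrix.mulVec_sub, Matrix.mulVec_sub, h₁, h₂,
      gram_mulVec_ridge hlam, gram_mulVec, hmom, WithLp.ofLp_add, WithLp.ofLp_add]
    abel
  have hq₁ := gram_mulVec_quadratic D u h₁
  have hq₂ := gram_mulVec_quadratic D u h₂
  have hsc : 0 < √c := Real.sqrt_pos.2 hc
  have hn₁ : ‖w₁‖ * √c ≤ √β := by
    refine Real.le_sqrt_of_sq_le ?_
    rw [mul_pow, Real.sq_sqrt hc.le]
    have := hexp w₁
    have := hnoise w₁ h₁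
    have : 0 ≤ lam * ‖w₁‖ ^ 2 := by positivity
    linarith
  have hn₂ : ‖w₂‖ * √c ≤ √lam := by
    refine Real.le_sqrt_of_sq_le ?_
    rw [mul_pow, Real.sq_sqrt hc.le]
    have he := hexp w₂
    have hin : inner ℝ w₂ (lam • θ) ≤ lam * ‖w₂‖ := by
      rw [inner_smul_right]
      exact mul_le_mul_of_nonneg_left ((real_inner_le_norm _ _).trans
        (mul_le_of_le_one_right (norm_nonneg _) hθ)) hlam.le
    -- The regularisation term of the quadratic form is kept here: `c‖w₂‖² ≤ λ(‖w₂‖ - ‖w₂‖²) ≤ λ`.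
    nlinarith [mul_nonneg hlam.le (sq_nonneg (‖w₂‖ - 1)), mul_nonneg hlam.le (norm_nonneg w₂)]
  rw [hdecomp, le_div_iff₀ hsc]
  nlinarith [mul_le_mul_of_nonneg_right (norm_sub_le w₁ w₂) hsc.le]

end Ridge

/-! ### The underestimation policy -/

section Policy

variable {ι : Type*} [Fintype ι] {N : ι → ℕ} {d : ℕ}

lemma ciWidth_nonneg (p : Params) (U d n : ℕ) : 0 ≤ ciWidth p U d n := by
  unfold ciWidth; positivity

/-- Under the underestimation policy, the estimates of connected users are not separated. -/
lemma lowerGap_nonpos_of_adj {p : Params} (hα : 0 ≤ p.α) {D : Dataset ι N d} {u v : ι}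
    (h : (connGraph p D (underestimate p D u)).Adj u v) : lowerGap p D u v ≤ 0 := by
  obtain ⟨hne, hlt, -⟩ := h
  have hci := mul_nonneg hα (add_nonneg (ciWidth_nonneg p (Fintype.card ι) d (N u))
    (ciWidth_nonneg p (Fintype.card ι) d (N v)))
  by_contra! hpos
  have hmem : v ∈ separatedUsers p D u := by simp [separatedUsers, hne.symm, hpos]
  have hle : underestimate p D u ≤ lowerGap p D u v := by
    rw [underestimate, dif_pos ⟨v, hmem⟩]
    exact Finset.inf'_le _ hmem
  rw [lowerGap] at hle
  linarith

/-- The condition on `δ` makes `log(1 + n/(λd))` at most `log(2U/δ)`, so the first radicand is at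
most `2 max{2,d} log(2U/δ)`; the condition on `λ` bounds `√λ` by the same root. The two roots and
two factors `√2` give the constant 4. -/
lemma ciWidth_le {p : Params} {U d n : ℕ} (hd : 0 < d) (hn : 0 < n) (hU : 0 < U)
    (hlam : 0 < p.lam) (hδ : p.δ ∈ Set.Ioo (0 : ℝ) 1) (ht : 0 < p.lamT)
    (hlam_le : p.lam ≤ d * Real.log (1 + n / (p.lam * d)) + 2 * Real.log (2 * U / p.δ))
    (hδ_le : p.δ ≤ 2 * U / (1 + n / (p.lam * d))) :
    ciWidth p U d n
      ≤ 4 * √(Real.log (2 * U / p.δ) * max 2 (d : ℝ)) / √p.lamT * (1 / √(n : ℝ)) := by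
  have hd' : (0 : ℝ) < d := by exact_mod_cast hd
  have hn' : (0 : ℝ) < n := by exact_mod_cast hn
  have hδ0 := hδ.1
  set L := Real.log (2 * U / p.δ) with hL
  set m : ℝ := max 2 (d : ℝ) with hm
  have hL0 : 0 ≤ L := by
    rw [hL, (log_two_mul_card_div hU hδ).2]
    have := (log_two_mul_card_div hU hδ).1
    have := Real.log_pos (show (1 : ℝ) < 2 by norm_num)
    linarith
  have hq : Real.log (1 + n / (p.lam * d)) ≤ L := by
    refine Real.log_le_log (by positivity) ?_
    rw [le_div_iff₀ (by positivity)] at hδ_le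
    rw [le_div_iff₀ hδ0]; linarith
  set A := d * Real.log (1 + n / (p.lam * d)) + 2 * L with hA
  have hA2 : A ≤ 2 * (L * m) := by
    have h1 : d * Real.log (1 + n / (p.lam * d)) ≤ m * L :=
      (mul_le_mul_of_nonneg_left hq hd'.le).trans
        (mul_le_mul_of_nonneg_right (le_max_right _ _) hL0)
    have h2 : 2 * L ≤ m * L := mul_le_mul_of_nonneg_right (le_max_left _ _) hL0
    linarith
  have hs : √A + √p.lam ≤ 2 * √(2 * (L * m)) := by
    have h1 := Real.sqrt_le_sqrt hA2
    have h2 := Real.sqrt_le_sqrt (hlam_le.trans hA2)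
    linarith
  have hden : √(p.lamT * n / 2) = √p.lamT * √(n : ℝ) / √2 := by
    rw [Real.sqrt_div (by positivity), Real.sqrt_mul ht.le]
  have h1 : 0 < √p.lamT := Real.sqrt_pos.2 ht
  have h2 : 0 < √(n : ℝ) := Real.sqrt_pos.2 hn'
  have h3 : √(2 : ℝ) * √2 = 2 := Real.mul_self_sqrt (by norm_num)
  unfold ciWidth
  rw [hden]
  calc (√A + √p.lam) / (√p.lamT * √(n : ℝ) / √2)
      ≤ (2 * √(2 * (L * m))) / (√p.lamT * √(n : ℝ) / √2) := by gcongr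
    _ = 2 * (√2 * √2) * √(L * m) / (√p.lamT * √(n : ℝ)) := by
        rw [Real.sqrt_mul (by norm_num : (0 : ℝ) ≤ 2)]; field_simp
    _ = _ := by rw [h3]; field_simp; ring

/-- If the confidence intervals are valid, then the heterogeneous neighbours of a user under the
underestimation policy are close to this user. -/
lemma le_of_mem_heteroNeighbors {p : Params} {θ : ι → Vec d} {D : Dataset ι N d} (hd : 0 < d)
    (hN : ∀ u, 0 < N u) (hα : 1 ≤ p.α) (hlam : 0 < p.lam) (hδ : p.δ ∈ Set.Ioo (0 : ℝ) 1)
    (hlam_le : ∀ u, p.lam ≤ d * Real.log (1 + N u / (p.lam * d))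
      + 2 * Real.log (2 * Fintype.card ι / p.δ))
    (hδ_le : ∀ u, p.δ ≤ 2 * Fintype.card ι / (1 + N u / (p.lam * d))) (ht : 0 < p.lamT)
    (hgood : ∀ u, nMin p (Fintype.card ι) d ≤ N u →
      ‖ridge p.lam D u - θ u‖ ≤ ciWidth p (Fintype.card ι) d (N u)) {u v : ι}
    (hv : v ∈ heteroNeighbors θ p D (underestimate p D u) u) :
    √p.lamT / (4 * (p.α + 1) * √(Real.log (2 * Fintype.card ι / p.δ) * max 2 (d : ℝ)))
        * ‖θ u - θ v‖ ≤ 1 / √(N u : ℝ) + 1 / √(N v : ℝ) := by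
  obtain ⟨hv, hne⟩ := hv
  have hadj : (connGraph p D (underestimate p D u)).Adj u v := by
    rcases hv with rfl | hv
    · exact absurd rfl hne
    · exact hv
  have hU : 0 < Fintype.card ι := Fintype.card_pos_iff.2 ⟨u⟩
  have hgap := lowerGap_nonpos_of_adj (by linarith) hadj
  rw [lowerGap] at hgap
  have hu := hgood u (hadj.2.2.trans (min_le_left _ _))
  have hv := hgood v (hadj.2.2.trans (min_le_right _ _))
  have hcu := ciWidth_le hd (hN u) hU hlam hδ ht (hlam_le u) (hδ_le u)
  have hcv := ciWidth_le hd (hN v) hU hlam hδ ht (hlam_le v) (hδ_le v)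
  set Q := √(Real.log (2 * Fintype.card ι / p.δ) * max 2 (d : ℝ)) with hQ
  have hQ0 : 0 < Q := by
    refine Real.sqrt_pos.2 (mul_pos ?_ (lt_max_of_lt_left two_pos))
    rw [(log_two_mul_card_div hU hδ).2]
    have := (log_two_mul_card_div hU hδ).1
    have := Real.log_pos (show (1 : ℝ) < 2 by norm_num)
    linarith
  have hst : 0 < √p.lamT := Real.sqrt_pos.2 ht
  have htri : ‖θ u - θ v‖ ≤ ‖ridge p.lam D u - θ u‖ + ‖ridge p.lam D u - ridge p.lam D v‖
      + ‖ridge p.lam D v - θ v‖ := by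
    have : θ u - θ v = -(ridge p.lam D u - θ u) + (ridge p.lam D u - ridge p.lam D v)
        + (ridge p.lam D v - θ v) := by abel
    rw [this]
    refine (norm_add_le _ _).trans (add_le_add_left ((norm_add_le _ _).trans ?_) _)
    rw [norm_neg]
  have hfin : ‖θ u - θ v‖ ≤ (p.α + 1) * (4 * Q / √p.lamT)
      * (1 / √(N u : ℝ) + 1 / √(N v : ℝ)) := by
    calc ‖θ u - θ v‖ ≤ (p.α + 1) * (ciWidth p (Fintype.card ι) d (N u)
          + ciWidth p (Fintype.card ι) d (N v)) := by linarith
      _ ≤ (p.α + 1) * (4 * Q / √p.lamT * (1 / √(N u : ℝ)) + 4 * Q / √p.lamT * (1 / √(N v : ℝ))) :=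
          mul_le_mul_of_nonneg_left (add_le_add hcu hcv) (by linarith)
      _ = _ := by ring
  have hα' : 0 < p.α + 1 := by linarith
  calc √p.lamT / (4 * (p.α + 1) * Q) * ‖θ u - θ v‖
      ≤ √p.lamT / (4 * (p.α + 1) * Q) * ((p.α + 1) * (4 * Q / √p.lamT)
      * (1 / √(N u : ℝ) + 1 / √(N v : ℝ))) := by gcongr
    _ = _ := by
      generalize 1 / √(N u : ℝ) + 1 / √(N v : ℝ) = z
      field_simp

end Policy

/-! ### Failure probability and union over users -/

section Data

variable {Ω : Type*} [mΩ : MeasurableSpace Ω] {P : Measure Ω} [IsProbabilityMeasure P]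
  {ι : Type*} {N : ι → ℕ} {d : ℕ} {ρ : Measure (Vec d)} {lamA σ : ℝ} {S : ℕ} {θ : ι → Vec d}
  {R : ι → Kernel (Vec d) ℝ} {K : (u : ι) → Fin (N u) → ℕ}
  {X : (u : ι) → (i : Fin (N u)) → Fin (K u i) → Ω → Vec d}
  {a : (u : ι) → Fin (N u) → Ω → Vec d} {r : (u : ι) → Fin (N u) → Ω → ℝ}

/-- The confidence interval of a user with enough samples fails with small probability. -/
lemma IsOfflineData.measure_ciWidth_lt_le (hdata : IsOfflineData P ρ S R K X a r)
    (hρ : ActionRegularity ρ lamA σ) (hR : RewardModel θ R) (hd : 0 < d) (u : ι) (hN : 0 < N u)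
    (hθ : ‖θ u‖ ≤ 1) {p : Params} (hlamT : p.lamT = smoothedParam lamA σ S) (ht : 0 < p.lamT)
    (hlam : 0 < p.lam) (hδ : p.δ ∈ Set.Ioo (0 : ℝ) 1) {U : ℕ} (hU : 0 < U)
    (hn : nMin p U d ≤ N u) :
    P {ω | ciWidth p U d (N u) < ‖ridge p.lam (fun u i => (a u i ω, r u i ω)) u - θ u‖}
      ≤ ENNReal.ofReal (p.δ / U) := by
  have hU' : (0 : ℝ) < U := by exact_mod_cast hU
  have hN' : (0 : ℝ) < N u := by exact_mod_cast hN
  have hδ0 := hδ.1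
  -- With this `ε`, `log(1/ε) = log(2U/δ)`, which matches the numerator of the confidence width.
  have hε : 0 < p.δ / (2 * U) := by positivity
  have h1 := hdata.measure_self_normalized_gt_le hρ.norm_le_one hR u hd hlam hε
  have h2 := hdata.measure_poor_exploration_le hρ u hd hU hδ hlamT ht hn
  rw [one_div_div] at h1
  calc _ ≤ _ := measure_mono fun ω hω => ?_
    _ ≤ _ := measure_union_le _ _
    _ ≤ _ := add_le_add h1 h2
    _ = ENNReal.ofReal (p.δ / U) := by
      rw [← ENNReal.ofReal_add hε.le hε.le]; congr 1; field_simp; ring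
  by_contra hcon
  simp only [Set.mem_union, Set.mem_ofPred_eq, not_or, not_exists, not_and, not_lt, not_le] at hcon
  obtain ⟨hnoise, hexpl⟩ := hcon
  rw [Set.mem_ofPred_eq] at hω
  refine absurd hω (not_lt.2 ?_)
  unfold ciWidth
  refine norm_ridge_sub_le hlam (fun u i => (a u i ω, r u i ω)) u hθ (by positivity) ?_ hnoise
  intro x
  rcases eq_or_ne x 0 with rfl | hx
  · simp
  have hx0 : ‖x‖ ≠ 0 := norm_ne_zero_iff.2 hx
  have h := (hexpl ((‖x‖⁻¹ : ℝ) • x) (by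
    rw [norm_smul, norm_inv, norm_norm, inv_mul_cancel₀ hx0])).le
  have hs : ∑ i, (inner ℝ ((‖x‖⁻¹ : ℝ) • x) (a u i ω)) ^ 2
      = (∑ i, (inner ℝ x (a u i ω)) ^ 2) / ‖x‖ ^ 2 := by
    rw [Finset.sum_div]
    refine Finset.sum_congr rfl fun i _ => ?_
    rw [real_inner_smul_left, mul_pow, inv_pow, inv_mul_eq_div]
  rw [hs, le_div_iff₀ (by positivity)] at h
  exact h

end Data

end OffClusBand

theorem mainTheorem7
    {Ω : Type*} [MeasurableSpace Ω] (P : Measure Ω) [IsProbabilityMeasure P]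
    {ι : Type*} [Fintype ι] (d : ℕ) (hd : 0 < d)
    (N : ι → ℕ) (hN : ∀ u, 0 < N u)
    (θ : ι → OffClusBand.Vec d) (hθ : ∀ u, ‖θ u‖ ≤ 1)
    (ρ : Measure (OffClusBand.Vec d)) (lamA σ : ℝ)
    (hρ : OffClusBand.ActionRegularity ρ lamA σ) (S : ℕ)
    (R : ι → Kernel (OffClusBand.Vec d) ℝ) (hR : OffClusBand.RewardModel θ R)
    (K : (u : ι) → Fin (N u) → ℕ)
    (X : (u : ι) → (i : Fin (N u)) → Fin (K u i) → Ω → OffClusBand.Vec d)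
    (a : (u : ι) → Fin (N u) → Ω → OffClusBand.Vec d) (r : (u : ι) → Fin (N u) → Ω → ℝ)
    (hdata : OffClusBand.IsOfflineData P ρ S R K X a r)
    (p : OffClusBand.Params) (hlamT : p.lamT = OffClusBand.smoothedParam lamA σ S)
    (hα : 1 ≤ p.α) (hlam : 0 < p.lam) (hδ : p.δ ∈ Set.Ioo (0 : ℝ) 1)
    (hlam_le : ∀ u, p.lam ≤ d * Real.log (1 + N u / (p.lam * d))
      + 2 * Real.log (2 * Fintype.card ι / p.δ))
    (hδ_le : ∀ u, p.δ ≤ 2 * Fintype.card ι / (1 + N u / (p.lam * d)))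
    (uTest : ι) :
    ENNReal.ofReal (1 - p.δ) ≤ P {ω |
      let D : OffClusBand.Dataset ι N d := fun u i => (a u i ω, r u i ω)
      let γhat : ℝ := OffClusBand.underestimate p D uTest
      let αw : ℝ := √p.lamT
        / (4 * (p.α + 1) * √(Real.log (2 * Fintype.card ι / p.δ) * max 2 (d : ℝ)))
      ∀ v ∈ OffClusBand.heteroNeighbors θ p D γhat uTest,
        1 / √(N uTest : ℝ) + 1 / √(N v : ℝ) ≥ αw * ‖θ uTest - θ v‖} := by
  -- For a nonpositive parameter `√p.lamT` is 0 and the claim is trivial, so positivity of the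
  -- smoothing integral need not be shown.
  rcases le_or_gt p.lamT 0 with hle | hpos
  · refine (ENNReal.ofReal_le_ofReal (by linarith [hδ.1])).trans_eq
      (ENNReal.ofReal_one.trans (measure_univ (μ := P)).symm) |>.trans (measure_mono fun ω _ => ?_)
    intro v _
    rw [Real.sqrt_eq_zero_of_nonpos hle, zero_div, zero_mul]
    positivity
  have hU : 0 < Fintype.card ι := Fintype.card_pos_iff.2 ⟨uTest⟩
  have hU' : (0 : ℝ) < Fintype.card ι := by exact_mod_cast hU
  -- Users with too few samples are never connected, so their intervals may fail freely: their bad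
  -- event is empty.
  set bad : ι → Set Ω := fun u => {ω | OffClusBand.nMin p (Fintype.card ι) d ≤ N u ∧
    OffClusBand.ciWidth p (Fintype.card ι) d (N u)
      < ‖OffClusBand.ridge p.lam (fun u i => (a u i ω, r u i ω)) u - θ u‖} with hbad
  have hbad_le : ∀ u, P (bad u) ≤ ENNReal.ofReal (p.δ / Fintype.card ι) := by
    intro u
    by_cases hn : OffClusBand.nMin p (Fintype.card ι) d ≤ N u
    · exact (measure_mono fun ω hω => hω.2).trans (hdata.measure_ciWidth_lt_le hρ hR hd u (hN u)
        (hθ u) hlamT hpos hlam hδ hU hn)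
    · rw [show bad u = ∅ from Set.eq_empty_of_forall_notMem fun ω hω => hn hω.1]
      simp
  have hunion : P (⋃ u, bad u) ≤ ENNReal.ofReal p.δ := by
    calc P (⋃ u, bad u) ≤ ∑ u, P (bad u) := measure_iUnion_fintype_le P bad
      _ ≤ ∑ _u : ι, ENNReal.ofReal (p.δ / Fintype.card ι) := Finset.sum_le_sum fun u _ => hbad_le u
      _ = ENNReal.ofReal p.δ := by
        rw [Finset.sum_const, Finset.card_univ, nsmul_eq_mul, ← ENNReal.ofReal_natCast,
          ← ENNReal.ofReal_mul (by positivity), mul_div_cancel₀ _ hU'.ne']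
  rw [ENNReal.ofReal_sub _ hδ.1.le, ENNReal.ofReal_one, tsub_le_iff_right]
  refine le_trans ?_ (add_le_add_right hunion _)
  -- The good event and the bad union cover `Ω`; subadditivity then needs no measurability of
  -- either.
  refine le_trans ?_ (measure_union_le _ _)
  rw [← measure_univ (μ := P)]
  refine measure_mono fun ω _ => ?_
  rw [Set.mem_union, or_iff_not_imp_right]
  intro hω v hv
  refine OffClusBand.le_of_mem_heteroNeighbors hd hN hα hlam hδ hlam_le hδ_le hpos (fun u hu => ?_)
    hv
  by_contra! hlt
  exact hω (Set.mem_iUnion.2 ⟨u, hu, hlt⟩)
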